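/- Let $n\ge 3$, $m\ge 1$ and $r\in\mathbb N$, let $\varepsilon_1,\dots,\varepsilon_n\in\{1,-1\}$, and let $g$ be the pseudo-Euclidean metric $g_{ij}=\delta_{ij}\varepsilon_i$ on $\mathbb{R}^n$ with coordinates $x=(x_1,\dots,x_n)$. Let $(F^m,g_F)$ be a non-empty $m$-dimensional Einstein semi-Riemannian manifold with constant Ricci curvature $\lambda_F\in\mathbb R$, i.e. $Ric_{g_F}=\lambda_F\, g_F$. Let $f,\varphi,h:\mathbb{R}^n\to\mathbb{R}$ be smooth functions with $f>0$ and with $\varphi$ and $h$ nowhere zero, and let $\rho\in\mathbb{R}$. Consider the warped product $M=(\mathbb{R}^n,\overline g)\times_f F^m$, that is, $\mathbb R^n\times F$ with the metric $\widetilde g=\overline g+f^2g_F$, where $\overline g=\frac{1}{\varphi^2}g$, and regard $h$ as a function on $M$ that depends only on the base point. Denote by $u_{,x_i}$ and $u_{,x_ix_j}$ the first and second partial derivatives of a function $u$ on $\mathbb R^n$. Then $M$ is a quasi-Einstein manifold with $$Ric_{\widetilde g}-\frac{r}{h}Hess_{\widetilde g}h=\rho\,\widetilde g$$ if and only if $f,\varphi,h$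 satisfy at every point of $\mathbb R^n$ the following three families of equations: (1) for all $i,j=1,\dots,n$ with $i\neq j$, $$(n-2)fh\varphi_{,x_ix_j}-rf\varphi h_{,x_ix_j}-mh\varphi f_{,x_ix_j}-mh\varphi_{,x_i}f_{,x_j}-mh\varphi_{,x_j}f_{,x_i}-rf\varphi_{,x_i}h_{,x_j}-rf\varphi_{,x_j}h_{,x_i}=0;$$ (2) for all $i=1,\dots,n$, $$\varphi\left[(n-2)fh\varphi_{,x_ix_i}-rf\varphi h_{,x_ix_i}-mh\varphi f_{,x_ix_i}-2mh\varphi_{,x_i}f_{,x_i}-2rf\varphi_{,x_i}h_{,x_i}\right]$$ $$+\varepsilon_i\sum_{k=1}^n\varepsilon_k\left[fh\varphi\varphi_{,x_kx_k}-(n-1)fh(\varphi_{,x_k})^2+mh\varphi\varphi_{,x_k}f_{,x_k}+rf\varphi\varphi_{,x_k}h_{,x_k}\right]=\varepsilon_i\rho fh;$$ (3) $$\sum_{k=1}^n\varepsilon_k\left[-fh\varphi^2f_{,x_kx_k}+(n-2)fh\varphi\varphi_{,x_k}f_{,x_k}-(m-1)h\varphi^2(f_{,x_k})^2-rf\varphi^2f_{,x_k}h_{,x_k}\right]=h\left[\rho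 f^2-\lambda_F\right].$$ -/

import Mathlib

set_option maxSynthPendingDepth 3

open scoped Manifold ContDiff

noncomputable section

namespace SemiRiem

/-! ### Metrics on an open part of a vector space

`G : E → E →L[ℝ] E →L[ℝ] ℝ` is a metric written in a chart with values in `E`:
`G y v w` is the product at the point `y` of the constant vector fields `v` and `w`. -/

section Local

variable {E : Type*} [NormedAddCommGroup E] [NormedSpace ℝ E]

/-- Christoffel symbols of the first kind:
`(v, w, z) ↦ (∂_v G(w, z) + ∂_w G(v, z) - ∂_z G(v, w)) / 2`. -/
def christoffelFirst (G : E → E →L[ℝ] E →L[ℝ] ℝ) (y : E) : E →L[ℝ] E →L[ℝ] E →L[ℝ] ℝ :=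
  (1 / 2 : ℝ) • (fderiv ℝ G y + (fderiv ℝ G y).flip -
    ((ContinuousLinearMap.flipₗᵢ ℝ E E ℝ).toContinuousLinearEquiv.toContinuousLinearMap ∘L
      (fderiv ℝ G y).flip : E →L[ℝ] E →L[ℝ] E →L[ℝ] ℝ))

theorem christoffelFirst_apply (G : E → E →L[ℝ] E →L[ℝ] ℝ) (y v w z : E) :
    christoffelFirst G y v w z =
      (1 / 2 : ℝ) * (fderiv ℝ G y v w z + fderiv ℝ G y w v z - fderiv ℝ G y z v w) := by
  simp [christoffelFirst]

/-- Christoffel symbols `Γ(v, w)` of the Levi-Civita connection: for nondegenerate `G y`, the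
vector with `G y (Γ(v, w)) z = christoffelFirst G y v w z` for all `z`. -/
def christoffel (G : E → E →L[ℝ] E →L[ℝ] ℝ) (y : E) : E →L[ℝ] E →L[ℝ] E :=
  (ContinuousLinearMap.compL ℝ E (E →L[ℝ] ℝ) E (G y).inverse) ∘L christoffelFirst G y

theorem christoffel_apply (G : E → E →L[ℝ] E →L[ℝ] ℝ) (y v w : E) :
    christoffel G y v w = (G y).inverse (christoffelFirst G y v w) := by
  simp [christoffel]

/-- The curvature operator `z ↦ R(z, v) w`, where `R(X, Y) = [∇_X, ∇_Y] - ∇_[X, Y]`: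
`R(z, v) w = ∂_z Γ(v, w) - ∂_v Γ(z, w) + Γ(z, Γ(v, w)) - Γ(v, Γ(z, w))`. -/
def curvatureOp (G : E → E →L[ℝ] E →L[ℝ] ℝ) (y v w : E) : E →ₗ[ℝ] E where
  toFun z :=
    fderiv ℝ (christoffel G) y z v w - fderiv ℝ (christoffel G) y v z w
      + christoffel G y z (christoffel G y v w) - christoffel G y v (christoffel G y z w)
  map_add' z z' := by
    simp only [map_add, add_apply]; abel
  map_smul' c z := by
    simp only [map_smul, smul_apply, RingHom.id_apply, smul_sub, smul_add]

/-- Ricci tensor `Ric(v, w) = tr (z ↦ R(z, v) w)` of the metric `G` at the point `y`. -/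
def ricciLocal (G : E → E →L[ℝ] E →L[ℝ] ℝ) (y v w : E) : ℝ :=
  LinearMap.trace ℝ E (curvatureOp G y v w)

/-- Hessian `Hess u (v, w) = ∂_v ∂_w u - (Γ(v, w)) u` of the function `u` at the point `y`. -/
def hessLocal (G : E → E →L[ℝ] E →L[ℝ] ℝ) (u : E → ℝ) (y v w : E) : ℝ :=
  fderiv ℝ (fderiv ℝ u) y v w - fderiv ℝ u y (christoffel G y v w)

end Local

/-! ### Semi-Riemannian manifolds (without boundary) -/

section Global

variable {E : Type*} [NormedAddCommGroup E] [NormedSpace ℝ E]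
  {H : Type*} [TopologicalSpace H] (I : ModelWithCorners ℝ E H)
  {M : Type*} [TopologicalSpace M] [ChartedSpace H M]

/-- A field of continuous bilinear forms on the tangent spaces of `M`. -/
abbrev TensorField₂ (M : Type*) [TopologicalSpace M] [ChartedSpace H M] : Type _ :=
  ∀ p : M, TangentSpace I p →L[ℝ] TangentSpace I p →L[ℝ] ℝ

/-- `g` is a semi-Riemannian metric: a smooth, symmetric and nondegenerate `(0,2)`-tensor field,
of any index. -/
structure IsSemiRiemannian [IsManifold I ∞ M] (g : TensorField₂ I M) : Prop where
  symm : ∀ (p : M) (v w : TangentSpace I p), g p v w = g p w v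
  nondegenerate : ∀ (p : M) (v : TangentSpace I p), (∀ w : TangentSpace I p, g p v w = 0) → v = 0
  smooth : ContMDiff I (I.prod 𝓘(ℝ, E →L[ℝ] E →L[ℝ] ℝ)) ∞
    (fun p : M => Bundle.TotalSpace.mk' (E →L[ℝ] E →L[ℝ] ℝ)
      (E := fun p : M => TangentSpace I p →L[ℝ] TangentSpace I p →L[ℝ] ℝ) p (g p))

/-- The bilinear form `b(A ·, A ·)`. -/
def pullForm {V W : Type*} [AddCommGroup V] [Module ℝ V] [TopologicalSpace V]
    [IsTopologicalAddGroup V] [ContinuousSMul ℝ V]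
    [AddCommGroup W] [Module ℝ W] [TopologicalSpace W]
    [IsTopologicalAddGroup W] [ContinuousSMul ℝ W]
    (b : W →L[ℝ] W →L[ℝ] ℝ) (A : V →L[ℝ] W) : V →L[ℝ] V →L[ℝ] ℝ :=
  (ContinuousLinearMap.precomp ℝ A) ∘L b ∘L A

theorem pullForm_apply {V W : Type*} [AddCommGroup V] [Module ℝ V] [TopologicalSpace V]
    [IsTopologicalAddGroup V] [ContinuousSMul ℝ V]
    [AddCommGroup W] [Module ℝ W] [TopologicalSpace W]
    [IsTopologicalAddGroup W] [ContinuousSMul ℝ W]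
    (b : W →L[ℝ] W →L[ℝ] ℝ) (A : V →L[ℝ] W) (v w : V) :
    pullForm b A v w = b (A v) (A w) := rfl

/-- The tensor field `g` written in the preferred chart at `p`, that is, its pullback under the
inverse of that chart. -/
def inChart (g : TensorField₂ I M) (p : M) (y : E) : E →L[ℝ] E →L[ℝ] ℝ :=
  pullForm (V := E) (g ((extChartAt I p).symm y)) (mfderiv 𝓘(ℝ, E) I (extChartAt I p).symm y)

theorem inChart_apply (g : TensorField₂ I M) (p : M) (y v w : E) :
    inChart I g p y v w =
      g ((extChartAt I p).symm y) (mfderiv 𝓘(ℝ, E) I (extChartAt I p).symm y v)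
        (mfderiv 𝓘(ℝ, E) I (extChartAt I p).symm y w) := rfl

/-- The differential at `p` of the preferred chart at `p`. -/
def chartDiff (p : M) : TangentSpace I p →L[ℝ] E :=
  mfderiv I 𝓘(ℝ, E) (extChartAt I p) p

/-- Ricci tensor of `(M, g)` at `p`, computed in the preferred chart at `p`
(being a tensor, it does not depend on the chart around `p`). -/
def ricci (g : TensorField₂ I M) (p : M) (v w : TangentSpace I p) : ℝ :=
  ricciLocal (inChart I g p) (extChartAt I p p) (chartDiff I p v) (chartDiff I p w)

/-- Hessian of the function `u` on `(M, g)` at `p`, computed in the preferred chart at `p`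
(being a tensor, it does not depend on the chart around `p`). -/
def hess (g : TensorField₂ I M) (u : M → ℝ) (p : M) (v w : TangentSpace I p) : ℝ :=
  hessLocal (inChart I g p) (u ∘ (extChartAt I p).symm) (extChartAt I p p)
    (chartDiff I p v) (chartDiff I p w)

/-- `(M, g)` is an Einstein manifold with constant Ricci curvature `lam`: `Ric = lam g`. -/
structure IsEinstein [IsManifold I ∞ M] (g : TensorField₂ I M) (lam : ℝ) : Prop where
  semiRiemannian : IsSemiRiemannian I g
  ricci_eq : ∀ (p : M) (v w : TangentSpace I p), ricci I g p v w = lam * g p v w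

/-- `(M, g, h)` is a quasi-Einstein manifold: `Ric - (r / h) Hess h = ρ g`, where `h` is a smooth
function without zeros. -/
structure IsQuasiEinstein [IsManifold I ∞ M] (g : TensorField₂ I M) (r : ℝ) (h : M → ℝ) (ρ : ℝ) :
    Prop where
  semiRiemannian : IsSemiRiemannian I g
  smooth : ContMDiff I 𝓘(ℝ, ℝ) ∞ h
  ne_zero : ∀ p : M, h p ≠ 0
  quasi_einstein_eq : ∀ (p : M) (v w : TangentSpace I p),
    ricci I g p v w - r / h p * hess I g h p v w = ρ * g p v w

/-- The warped product metric `π* g_B + (f ∘ π)² σ* g_F` on `B × F`, where `π` and `σ` are the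
two projections. -/
def warpedMetric {E' : Type*} [NormedAddCommGroup E'] [NormedSpace ℝ E']
    {H' : Type*} [TopologicalSpace H'] (J : ModelWithCorners ℝ E' H')
    {F : Type*} [TopologicalSpace F] [ChartedSpace H' F]
    (gB : TensorField₂ I M) (f : M → ℝ) (gF : TensorField₂ J F) :
    TensorField₂ (I.prod J) (M × F) := fun p =>
  pullForm (gB p.1) (mfderiv (I.prod J) I Prod.fst p)
    + (f p.1) ^ 2 • pullForm (gF p.2) (mfderiv (I.prod J) J Prod.snd p)

end Global

/-! ### Pseudo-Euclidean space -/

section PseudoEuclidean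

variable {n : ℕ}

/-- The bilinear form `∑ i, ε i * v i * w i` on `ℝⁿ`. -/
def pseudoForm (ε : Fin n → ℝ) :
    EuclideanSpace ℝ (Fin n) →L[ℝ] EuclideanSpace ℝ (Fin n) →L[ℝ] ℝ :=
  ∑ i, ε i • (EuclideanSpace.proj i : EuclideanSpace ℝ (Fin n) →L[ℝ] ℝ).smulRight
    (EuclideanSpace.proj i : EuclideanSpace ℝ (Fin n) →L[ℝ] ℝ)

theorem pseudoForm_apply (ε : Fin n → ℝ) (v w : EuclideanSpace ℝ (Fin n)) :
    pseudoForm ε v w = ∑ i, ε i * v i * w i := by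
  simp [pseudoForm, mul_assoc]

/-- The metric `g / φ²` on `ℝⁿ`, where `g` is the pseudo-Euclidean metric `g_ij = δ_ij ε_i`. -/
def conformalMetric (ε : Fin n → ℝ) (φ : EuclideanSpace ℝ (Fin n) → ℝ) :
    TensorField₂ (𝓡 n) (EuclideanSpace ℝ (Fin n)) := fun x =>
  (1 / (φ x) ^ 2) • (pseudoForm ε : EuclideanSpace ℝ (Fin n) →L[ℝ] EuclideanSpace ℝ (Fin n) →L[ℝ] ℝ)

/-- The partial derivative of `u` with respect to the coordinate `x_i`. -/
def pd (i : Fin n) (u : EuclideanSpace ℝ (Fin n) → ℝ) (x : EuclideanSpace ℝ (Fin n)) : ℝ :=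
  fderiv ℝ u x (EuclideanSpace.single i 1)

/-- The second partial derivative of `u`, first with respect to `x_i`, then to `x_j`. -/
def pd₂ (i j : Fin n) (u : EuclideanSpace ℝ (Fin n) → ℝ) (x : EuclideanSpace ℝ (Fin n)) : ℝ :=
  pd j (pd i u) x

end PseudoEuclidean

end SemiRiem

end

/-! Everything rests on O'Neill's formulas for a warped product with `m`-dimensional fibre. Write
`b` for the base metric and `k` for the fibre metric. Then Ric = Ric_b - (m/f) Hess_b f + Ric_k - (f
Δ_b f + (m-1)|∇f|²) k, and Hess h = Hess_b h + f⟨∇f, ∇h⟩ k when `h` lives on the base. Neither has a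
mixed component. If Ric_k = λ k, the tensor Ric - (r/h) Hess h - ρ g̃ is therefore a bilinear form
on the base plus a scalar function on the base times `k` (`ricci_sub_hess_sub_warpedMetric`). A
fibre metric is nonzero when `m ≥ 1`, so the tensor vanishes iff `baseDefect` and `fibreDefect` both
vanish.

For b = φ⁻²P with P constant, Ric_b, Hess_b and Δ_b are explicit in the flat derivatives of `φ` and
`f`. Multiplying `baseDefect` by φ²fh and evaluating it on coordinate vectors gives φ times the
off-diagonal equations for i ≠ j and the diagonal equations for i = j. Multiplying `fibreDefect` by
h gives the last equation.

The curvature formulas (`ricciLocal_warpedLocal`, `ricciLocal_conformalLocal`) are proved for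
metrics on vector spaces: Christoffel symbols are verified against the Koszul formula,
differentiated, and the curvature operator is traced. Charts carry the result to the manifold. -/

noncomputable section

open Filter Topology

namespace SemiRiem

/-! ### Tensor fields and metrics read in the preferred chart. -/

section SmoothInChart

variable {E : Type*} [NormedAddCommGroup E] [NormedSpace ℝ E]
  {H : Type*} [TopologicalSpace H] (I : ModelWithCorners ℝ E H)
  {M : Type*} [TopologicalSpace M] [ChartedSpace H M]

theorem inChart_chart_apply [IsManifold I ∞ M] [I.Boundaryless] (g : TensorField₂ I M) (p x : M)
    (hx : x ∈ (chartAt H p).source) (v w : E) :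
    inChart I g p (extChartAt I p x) v w =
      g x ((trivializationAt E (TangentSpace I) p).symmL ℝ x v)
        ((trivializationAt E (TangentSpace I) p).symmL ℝ x w) := by
  have : IsManifold I 1 M := IsManifold.of_le (n := ∞) (by simp)
  have h1 : (extChartAt I p).symm (extChartAt I p x) = x :=
    (extChartAt I p).left_inv (by rwa [extChartAt_source])
  rw [TangentBundle.symmL_trivializationAt hx, inChart_apply, h1, I.range_eq_univ,
    mfderivWithin_univ]
  rfl

theorem trivializationAt_tensorField_apply [IsManifold I ∞ M] [I.Boundaryless]
    (g : TensorField₂ I M) (p x : M) (hx : x ∈ (chartAt H p).source) :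
    (trivializationAt (E →L[ℝ] E →L[ℝ] ℝ)
      (fun p : M => TangentSpace I p →L[ℝ] TangentSpace I p →L[ℝ] ℝ) p
      (Bundle.TotalSpace.mk' (E →L[ℝ] E →L[ℝ] ℝ) x (g x))).2 =
    inChart I g p (extChartAt I p x) := by
  ext v w
  rw [inChart_chart_apply I g p x hx, hom_trivializationAt_apply]
  have hx' : x ∈ (trivializationAt (E →L[ℝ] ℝ)
      (fun p : M => TangentSpace I p →L[ℝ] ℝ) p).baseSet := by
    simpa using hx
  simp only [ContinuousLinearMap.inCoordinates, ContinuousLinearMap.comp_apply,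
    Bundle.Trivialization.continuousLinearMapAt_apply,
    Bundle.Trivialization.coe_linearMapAt_of_mem _ hx']
  erw [hom_trivializationAt_apply]
  simp [ContinuousLinearMap.inCoordinates]

/-- Bridge between smoothness of a bundle section and ordinary calculus: near `p` the trivialization
of the form bundle reads `g` as its chart expression, and the chart and its inverse are smooth. -/
theorem contMDiffAt_tensorField_iff [IsManifold I ∞ M] [I.Boundaryless] (g : TensorField₂ I M)
    (p : M) :
    ContMDiffAt I (I.prod 𝓘(ℝ, E →L[ℝ] E →L[ℝ] ℝ)) ∞
    (fun p : M => Bundle.TotalSpace.mk' (E →L[ℝ] E →L[ℝ] ℝ)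
      (E := fun p : M => TangentSpace I p →L[ℝ] TangentSpace I p →L[ℝ] ℝ) p (g p)) p ↔
    ContDiffAt ℝ ∞ (inChart I g p) (extChartAt I p p) := by
  rw [Bundle.contMDiffAt_section]
  have h0 : (fun x => (trivializationAt (E →L[ℝ] E →L[ℝ] ℝ)
      (fun p : M => TangentSpace I p →L[ℝ] TangentSpace I p →L[ℝ] ℝ) p
      (Bundle.TotalSpace.mk' (E →L[ℝ] E →L[ℝ] ℝ) x (g x))).2) =ᶠ[𝓝 p]
      fun x => inChart I g p (extChartAt I p x) := by
    filter_upwards [(chartAt H p).open_source.mem_nhds (mem_chart_source H p)] with x hx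
    exact trivializationAt_tensorField_apply I g p x hx
  rw [h0.contMDiffAt_iff]
  constructor
  · intro h
    have h2 : ContMDiffAt 𝓘(ℝ, E) I ∞ (extChartAt I p).symm (extChartAt I p p) := by
      have := contMDiffWithinAt_extChartAt_symm_range (n := ∞) (I := I) p
        (mem_extChartAt_target (I := I) p)
      rwa [I.range_eq_univ, contMDiffWithinAt_univ] at this
    have h3 := ContMDiffAt.comp (extChartAt I p p) (g := fun x => inChart I g p (extChartAt I p x))
      (by rwa [extChartAt_to_inv]) h2
    rw [← contMDiffAt_iff_contDiffAt]
    refine h3.congr_of_eventuallyEq ?_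
    filter_upwards [extChartAt_target_mem_nhds (I := I) p] with y hy
    simp only [Function.comp_apply, (extChartAt I p).right_inv hy]
  · intro h
    exact (contMDiffAt_iff_contDiffAt.2 h).comp p contMDiffAt_extChartAt

theorem IsSemiRiemannian.contDiffAt_inChart [IsManifold I ∞ M] [I.Boundaryless]
    {g : TensorField₂ I M} (hg : IsSemiRiemannian I g) (p : M) :
    ContDiffAt ℝ ∞ (inChart I g p) (extChartAt I p p) :=
  (contMDiffAt_tensorField_iff I g p).1 (hg.smooth p)

/-- The tangent space at `p` is a copy of `E` identified through the preferred chart at `p`, so that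
chart has the identity as differential there. -/
theorem chartDiff_apply [IsManifold I ∞ M] (p : M) (v : TangentSpace I p) :
    chartDiff I p v = (v : E) := by
  have : IsManifold I 1 M := IsManifold.of_le (n := ∞) (by simp)
  rw [chartDiff, mfderiv_extChartAt_self]
  rfl

theorem inChart_self_apply [IsManifold I ∞ M] [I.Boundaryless] (g : TensorField₂ I M) (p : M)
    (v w : E) : inChart I g p (extChartAt I p p) v w = g p v w := by
  have : IsManifold I 1 M := IsManifold.of_le (n := ∞) (by simp)
  have h := mfderivWithin_range_extChartAt_symm (𝕜 := ℝ) (I := I) (x := p)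
  rw [inChart_chart_apply I g p p (mem_chart_source H p),
    TangentBundle.symmL_trivializationAt (mem_chart_source H p), h]
  rfl

theorem IsSemiRiemannian.inChart_symm [IsManifold I ∞ M]
    {g : TensorField₂ I M} (hg : IsSemiRiemannian I g) (p : M) (y v w : E) :
    inChart I g p y v w = inChart I g p y w v := by
  rw [inChart_apply, inChart_apply, hg.symm]

theorem IsSemiRiemannian.inChart_nondegenerate [IsManifold I ∞ M] [I.Boundaryless]
    {g : TensorField₂ I M} (hg : IsSemiRiemannian I g) (p : M) {y : E}
    (hy : y ∈ (extChartAt I p).target) (v : E) (hv : ∀ w, inChart I g p y v w = 0) : v = 0 := by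
  have : IsManifold I 1 M := IsManifold.of_le (n := ∞) (by simp)
  have h1 := isInvertible_mfderivWithin_extChartAt_symm hy
  rw [I.range_eq_univ, mfderivWithin_univ] at h1
  obtain ⟨A, hA⟩ := h1
  have h2 : mfderiv 𝓘(ℝ, E) I (extChartAt I p).symm y v = 0 := by
    refine hg.nondegenerate _ _ fun w => ?_
    -- The differential of the inverse chart is onto, so testing against chart vectors tests against
    -- all tangent vectors.
    have h3 : mfderiv 𝓘(ℝ, E) I (extChartAt I p).symm y (A.symm w) = w := by
      rw [← hA]
      exact A.apply_symm_apply w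
    have h4 := (inChart_apply I g p y v (A.symm w)).symm.trans (hv _)
    rwa [h3] at h4
  rw [← hA] at h2
  exact A.injective (h2.trans (map_zero A).symm)

end SmoothInChart

/-! ### Warped products on vector spaces and in product charts. -/

section WarpedLocal

variable {B E : Type*} [NormedAddCommGroup B] [NormedSpace ℝ B]
  [NormedAddCommGroup E] [NormedSpace ℝ E]

/-- The warped product metric `b + f² k` on `B × E`, for metrics `b` and `k` on open parts of the
vector spaces `B` and `E`. -/
def warpedLocal (b : B → B →L[ℝ] B →L[ℝ] ℝ) (f : B → ℝ) (k : E → E →L[ℝ] E →L[ℝ] ℝ)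
    (z : B × E) : B × E →L[ℝ] B × E →L[ℝ] ℝ :=
  pullForm (b z.1) (ContinuousLinearMap.fst ℝ B E)
    + f z.1 ^ 2 • pullForm (k z.2) (ContinuousLinearMap.snd ℝ B E)

@[simp]
theorem warpedLocal_apply (b : B → B →L[ℝ] B →L[ℝ] ℝ) (f : B → ℝ) (k : E → E →L[ℝ] E →L[ℝ] ℝ)
    (z v w : B × E) :
    warpedLocal b f k z v w = b z.1 v.1 w.1 + f z.1 ^ 2 * k z.2 v.2 w.2 := by
  simp [warpedLocal, pullForm_apply]

/-- `pullForm` as a continuous linear map of the form. -/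
def pullFormL {V W : Type*} [NormedAddCommGroup V] [NormedSpace ℝ V] [NormedAddCommGroup W]
    [NormedSpace ℝ W] (A : V →L[ℝ] W) : (W →L[ℝ] W →L[ℝ] ℝ) →L[ℝ] V →L[ℝ] V →L[ℝ] ℝ :=
  (ContinuousLinearMap.compL ℝ V (W →L[ℝ] ℝ) (V →L[ℝ] ℝ) (ContinuousLinearMap.precomp ℝ A)) ∘L
    ContinuousLinearMap.precomp (W →L[ℝ] ℝ) A

theorem contDiffAt_warpedLocal {b : B → B →L[ℝ] B →L[ℝ] ℝ} {f : B → ℝ}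
    {k : E → E →L[ℝ] E →L[ℝ] ℝ} {z : B × E} {N : WithTop ℕ∞}
    (hb : ContDiffAt ℝ N b z.1) (hf : ContDiffAt ℝ N f z.1)
    (hk : ContDiffAt ℝ N k z.2) : ContDiffAt ℝ N (warpedLocal b f k) z := by
  have h1 : ContDiffAt ℝ N (fun z : B × E => b z.1) z := hb.comp z contDiffAt_fst
  have h2 : ContDiffAt ℝ N (fun z : B × E => f z.1) z := hf.comp z contDiffAt_fst
  have h3 : ContDiffAt ℝ N (fun z : B × E => k z.2) z := hk.comp z contDiffAt_snd
  exact ((pullFormL (ContinuousLinearMap.fst ℝ B E)).contDiff.contDiffAt.comp z h1).add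
    ((h2.pow 2).smul ((pullFormL (ContinuousLinearMap.snd ℝ B E)).contDiff.contDiffAt.comp z h3))

end WarpedLocal

section WarpedChart

variable {B E : Type*} [NormedAddCommGroup B] [NormedSpace ℝ B]
  [NormedAddCommGroup E] [NormedSpace ℝ E]
  {H : Type*} [TopologicalSpace H] (J : ModelWithCorners ℝ E H)
  {F : Type*} [TopologicalSpace F] [ChartedSpace H F]

theorem warpedMetric_apply (b : TensorField₂ 𝓘(ℝ, B) B) (f : B → ℝ) (gF : TensorField₂ J F)
    (p : B × F) (v w : B × E) :
    warpedMetric 𝓘(ℝ, B) J b f gF p v w = b p.1 v.1 w.1 + f p.1 ^ 2 * gF p.2 v.2 w.2 := by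
  have h1 : mfderiv (𝓘(ℝ, B).prod J) 𝓘(ℝ, B) Prod.fst p = ContinuousLinearMap.fst ℝ B E :=
    mfderiv_fst
  have h2 : mfderiv (𝓘(ℝ, B).prod J) J Prod.snd p = ContinuousLinearMap.snd ℝ B E :=
    mfderiv_snd
  rw [warpedMetric, h1, h2]
  rfl

/-- The inverse product chart is the identity on `B` times the inverse chart of `F`; the chain rule
through the two projections computes the components of its differential. -/
theorem inChart_warpedMetric [IsManifold J ∞ F] [J.Boundaryless]
    (b : B → B →L[ℝ] B →L[ℝ] ℝ) (f : B → ℝ) (gF : TensorField₂ J F) (p : B × F) (z : B × E)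
    (hz : z.2 ∈ (extChartAt J p.2).target) :
    inChart (𝓘(ℝ, B).prod J) (warpedMetric 𝓘(ℝ, B) J b f gF) p z =
      warpedLocal b f (inChart J gF p.2) z := by
  have i1 : IsManifold J 1 F := IsManifold.of_le (n := ∞) (by simp)
  have i2 : IsManifold (𝓘(ℝ, B).prod J) 1 (B × F) := inferInstance
  have e0 : ∀ y, (extChartAt (𝓘(ℝ, B).prod J) p).symm y = (y.1, (extChartAt J p.2).symm y.2) := by
    intro y
    rw [extChartAt_prod]
    rfl
  have hz' : z ∈ (extChartAt (𝓘(ℝ, B).prod J) p).target := by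
    rw [extChartAt_prod, extChartAt_model_space_eq_id]
    exact ⟨trivial, hz⟩
  have d1 : MDifferentiableAt 𝓘(ℝ, B × E) (𝓘(ℝ, B).prod J)
      (extChartAt (𝓘(ℝ, B).prod J) p).symm z := by
    have := mdifferentiableWithinAt_extChartAt_symm hz'
    rwa [(𝓘(ℝ, B).prod J).range_eq_univ, mdifferentiableWithinAt_univ] at this
  have d2 : MDifferentiableAt 𝓘(ℝ, E) J (extChartAt J p.2).symm z.2 := by
    have := mdifferentiableWithinAt_extChartAt_symm hz
    rwa [J.range_eq_univ, mdifferentiableWithinAt_univ] at this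
  have c1 : mfderiv 𝓘(ℝ, B × E) 𝓘(ℝ, B) (Prod.fst ∘ (extChartAt (𝓘(ℝ, B).prod J) p).symm) z =
      ContinuousLinearMap.fst ℝ B E := by
    have : Prod.fst ∘ (extChartAt (𝓘(ℝ, B).prod J) p).symm = Prod.fst := by
      funext y; exact congrArg Prod.fst (e0 y)
    rw [this, mfderiv_eq_fderiv]
    exact fderiv_fst
  have c2 : mfderiv 𝓘(ℝ, B × E) J (Prod.snd ∘ (extChartAt (𝓘(ℝ, B).prod J) p).symm) z =
      (mfderiv 𝓘(ℝ, E) J (extChartAt J p.2).symm z.2) ∘L ContinuousLinearMap.snd ℝ B E := by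
    have : Prod.snd ∘ (extChartAt (𝓘(ℝ, B).prod J) p).symm =
        (extChartAt J p.2).symm ∘ (Prod.snd : B × E → E) := by
      funext y; exact congrArg Prod.snd (e0 y)
    rw [this, mfderiv_comp z d2 (differentiableAt_snd.mdifferentiableAt), mfderiv_eq_fderiv]
    congr 1
    exact fderiv_snd
  rw [mfderiv_comp z mdifferentiableAt_fst d1, mfderiv_fst] at c1
  rw [mfderiv_comp z mdifferentiableAt_snd d1, mfderiv_snd] at c2
  have c1' : ∀ v : B × E,
      (mfderiv 𝓘(ℝ, B × E) (𝓘(ℝ, B).prod J) (extChartAt (𝓘(ℝ, B).prod J) p).symm z v).1 = v.1 :=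
    fun v => DFunLike.congr_fun c1 v
  have c2' : ∀ v : B × E,
      (mfderiv 𝓘(ℝ, B × E) (𝓘(ℝ, B).prod J) (extChartAt (𝓘(ℝ, B).prod J) p).symm z v).2 =
        mfderiv 𝓘(ℝ, E) J (extChartAt J p.2).symm z.2 v.2 :=
    fun v => DFunLike.congr_fun c2 v
  refine ContinuousLinearMap.ext fun v => ContinuousLinearMap.ext fun w => ?_
  refine (inChart_apply (𝓘(ℝ, B).prod J) _ p z v w).trans ?_
  refine (warpedMetric_apply J b f gF _ _ _).trans ?_
  rw [warpedLocal_apply, inChart_apply, c1', c1', c2', c2', e0]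
  rfl

end WarpedChart

/-! ### Christoffel symbols, gradients and Hessians of a local metric. -/

section LocalMetric

variable {E : Type*} [NormedAddCommGroup E] [NormedSpace ℝ E]

/-- Lets explicit Christoffel symbols be verified by pairing a candidate with every `z`, without
inverting the metric. -/
theorem christoffel_eq_of_apply {G : E → E →L[ℝ] E →L[ℝ] ℝ} {y : E} (hG : (G y).IsInvertible)
    {v w u : E} (hu : ∀ z, G y u z = christoffelFirst G y v w z) : christoffel G y v w = u := by
  rw [christoffel_apply, ← ContinuousLinearMap.ext (f := G y u) hu, hG.inverse_apply_self]

theorem apply_christoffel {G : E → E →L[ℝ] E →L[ℝ] ℝ} {y : E} (hG : (G y).IsInvertible)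
    (v w z : E) : G y (christoffel G y v w) z = christoffelFirst G y v w z := by
  rw [christoffel_apply, hG.self_apply_inverse]

theorem isInvertible_of_nondegenerate [FiniteDimensional ℝ E] {b : E →L[ℝ] E →L[ℝ] ℝ}
    (hb : ∀ v, (∀ w, b v w = 0) → v = 0) : b.IsInvertible := by
  have hinj : Function.Injective (b : E →ₗ[ℝ] E →L[ℝ] ℝ) := by
    rw [← LinearMap.ker_eq_bot, LinearMap.ker_eq_bot']
    exact fun v hv => hb v fun w => DFunLike.congr_fun hv w
  have hdim : Module.finrank ℝ E = Module.finrank ℝ (E →L[ℝ] ℝ) := by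
    rw [← (LinearMap.toContinuousLinearMap (𝕜 := ℝ) (E := E) (F' := ℝ)).finrank_eq]
    exact (Subspace.dual_finrank_eq (K := ℝ) (V := E)).symm
  exact ⟨(LinearEquiv.ofInjectiveOfFinrankEq _ hinj hdim).toContinuousLinearEquiv, by ext; rfl⟩

/-- Operator inversion is smooth at an invertible operator; the rest is linear in the derivative of
`G`. -/
theorem contDiffAt_christoffel [CompleteSpace E] {G : E → E →L[ℝ] E →L[ℝ] ℝ} {y : E}
    (hG : ContDiffAt ℝ ∞ G y) (hi : (G y).IsInvertible) : ContDiffAt ℝ ∞ (christoffel G) y := by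
  obtain ⟨A, hA⟩ := hi
  have h1 : ContDiffAt ℝ ∞ (fderiv ℝ G) y := hG.fderiv_right (by simp)
  have hflip : ContDiff ℝ ∞ (fun T : E →L[ℝ] E →L[ℝ] E →L[ℝ] ℝ => T.flip) :=
    (ContinuousLinearMap.flipₗᵢ ℝ E E (E →L[ℝ] ℝ)).contDiff
  have h2 : ContDiffAt ℝ ∞ (fun x => (fderiv ℝ G x).flip) y := hflip.contDiffAt.comp y h1
  have h3 : ContDiffAt ℝ ∞ (christoffelFirst G) y :=
    ((h1.add h2).sub (contDiffAt_const.clm_comp h2)).const_smul _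
  have h4 : ContDiffAt ℝ ∞ (fun x => (G x).inverse) y :=
    ContDiffAt.comp (g := ContinuousLinearMap.inverse) y (hA ▸ contDiffAt_map_inverse A) hG
  exact ((ContinuousLinearMap.compL ℝ E (E →L[ℝ] ℝ) E).contDiff.contDiffAt.comp y h4).clm_comp h3

theorem hasFDerivAt_clm_apply₂ {X V W U : Type*} [NormedAddCommGroup X] [NormedSpace ℝ X]
    [NormedAddCommGroup V] [NormedSpace ℝ V] [NormedAddCommGroup W] [NormedSpace ℝ W]
    [NormedAddCommGroup U] [NormedSpace ℝ U] {T : X → V →L[ℝ] W →L[ℝ] U} {x : X}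
    (hT : DifferentiableAt ℝ T x) (v : V) (w : W) :
    HasFDerivAt (fun x => T x v w) (((fderiv ℝ T x).flip v).flip w) x := by
  have := (hT.hasFDerivAt.clm_apply (hasFDerivAt_const v x)).clm_apply (hasFDerivAt_const w x)
  convert this using 1
  ext; simp

theorem christoffel_symm {G : E → E →L[ℝ] E →L[ℝ] ℝ} {y : E} (hG : DifferentiableAt ℝ G y)
    (hs : ∀ x v w, G x v w = G x w v) (v w : E) :
    christoffel G y v w = christoffel G y w v := by
  have h1 : ∀ z v w, fderiv ℝ G y z v w = fderiv ℝ G y z w v := by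
    intro z v w
    have e : (fun x => G x v w) = fun x => G x w v := funext fun x => hs x v w
    have h2 := hasFDerivAt_clm_apply₂ hG
    have h3 := h2 w v
    rw [← e] at h3
    exact DFunLike.congr_fun ((h2 v w).unique h3) z
  rw [christoffel_apply, christoffel_apply]
  congr 1
  ext z
  rw [christoffelFirst_apply, christoffelFirst_apply, h1 z v w]
  ring

/-- The gradient of the function `u` with respect to the metric `G`. -/
def gradLocal (G : E → E →L[ℝ] E →L[ℝ] ℝ) (u : E → ℝ) (y : E) : E :=
  (G y).inverse (fderiv ℝ u y)

/-- The Hessian of `u` as an endomorphism `z ↦ ∇_z (grad u)`. -/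
def hessOp (G : E → E →L[ℝ] E →L[ℝ] ℝ) (u : E → ℝ) (y : E) : E →L[ℝ] E :=
  fderiv ℝ (gradLocal G u) y + (christoffel G y).flip (gradLocal G u y)

theorem hessOp_apply (G : E → E →L[ℝ] E →L[ℝ] ℝ) (u : E → ℝ) (y z : E) :
    hessOp G u y z = fderiv ℝ (gradLocal G u) y z + christoffel G y z (gradLocal G u y) := by
  simp [hessOp]

theorem contDiffAt_gradLocal [CompleteSpace E] {G : E → E →L[ℝ] E →L[ℝ] ℝ} {u : E → ℝ} {y : E}
    (hG : ContDiffAt ℝ ∞ G y) (hi : (G y).IsInvertible) (hu : ContDiffAt ℝ ∞ u y) :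
    ContDiffAt ℝ ∞ (gradLocal G u) y := by
  obtain ⟨A, hA⟩ := hi
  have h4 : ContDiffAt ℝ ∞ (fun x => (G x).inverse) y :=
    ContDiffAt.comp (g := ContinuousLinearMap.inverse) y (hA ▸ contDiffAt_map_inverse A) hG
  exact h4.clm_apply (hu.fderiv_right (by simp))

end LocalMetric

/-! ### Christoffel symbols of a warped product. -/

section Warped

variable {B E : Type*} [NormedAddCommGroup B] [NormedSpace ℝ B]
  [NormedAddCommGroup E] [NormedSpace ℝ E]

/-- Only the diagonal blocks count: split `A` along the two inclusions and use cyclicity of the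
trace. -/
theorem trace_prod_eq [FiniteDimensional ℝ B] [FiniteDimensional ℝ E]
    (A : B × E →ₗ[ℝ] B × E) :
    LinearMap.trace ℝ (B × E) A =
      LinearMap.trace ℝ B (LinearMap.fst ℝ B E ∘ₗ A ∘ₗ LinearMap.inl ℝ B E) +
      LinearMap.trace ℝ E (LinearMap.snd ℝ B E ∘ₗ A ∘ₗ LinearMap.inr ℝ B E) := by
  have h : A = (A ∘ₗ LinearMap.inl ℝ B E) ∘ₗ LinearMap.fst ℝ B E +
      (A ∘ₗ LinearMap.inr ℝ B E) ∘ₗ LinearMap.snd ℝ B E := by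
    refine LinearMap.ext fun v => ?_
    simp [← map_add]
  conv_lhs => rw [h]
  rw [map_add, LinearMap.trace_comp_comm' (LinearMap.fst ℝ B E),
    LinearMap.trace_comp_comm' (LinearMap.snd ℝ B E)]

theorem fderiv_warpedLocal_apply {b : B → B →L[ℝ] B →L[ℝ] ℝ} {f : B → ℝ}
    {k : E → E →L[ℝ] E →L[ℝ] ℝ} {z : B × E} (hb : ContDiffAt ℝ 1 b z.1)
    (hf : ContDiffAt ℝ 1 f z.1) (hk : ContDiffAt ℝ 1 k z.2) (u v w : B × E) :
    fderiv ℝ (warpedLocal b f k) z u v w = fderiv ℝ b z.1 u.1 v.1 w.1 +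
      2 * f z.1 * fderiv ℝ f z.1 u.1 * k z.2 v.2 w.2 +
      f z.1 ^ 2 * fderiv ℝ k z.2 u.2 v.2 w.2 := by
  have h1 := hasFDerivAt_clm_apply₂
    ((contDiffAt_warpedLocal hb hf hk).differentiableAt one_ne_zero) v w
  have h2 := (hasFDerivAt_clm_apply₂ (hb.differentiableAt one_ne_zero) v.1 w.1).comp z
    (hasFDerivAt_fst (𝕜 := ℝ) (p := z))
  have h3 := ((hf.differentiableAt one_ne_zero).hasFDerivAt.comp z
    (hasFDerivAt_fst (𝕜 := ℝ) (p := z))).pow 2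
  have h4 := (hasFDerivAt_clm_apply₂ (hk.differentiableAt one_ne_zero) v.2 w.2).comp z
    (hasFDerivAt_snd (𝕜 := ℝ) (p := z))
  have h5 := h2.add (h3.mul h4)
  have e : (fun x => warpedLocal b f k x v w) =
      ((fun x => b x v.1 w.1) ∘ Prod.fst) + ((f ∘ Prod.fst) ^ 2) *
        ((fun x => k x v.2 w.2) ∘ Prod.snd) := by
    ext x
    simp
  rw [e] at h1
  have h6 := DFunLike.congr_fun (h1.unique h5) u
  simp at h6
  rw [h6]
  ring

theorem isInvertible_warpedLocal [FiniteDimensional ℝ B] [FiniteDimensional ℝ E]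
    {b : B → B →L[ℝ] B →L[ℝ] ℝ} {f : B → ℝ}
    {k : E → E →L[ℝ] E →L[ℝ] ℝ} {z : B × E} (hb : (b z.1).IsInvertible)
    (hf : f z.1 ≠ 0) (hk : (k z.2).IsInvertible) : (warpedLocal b f k z).IsInvertible := by
  refine isInvertible_of_nondegenerate fun v hv => ?_
  refine Prod.ext ?_ ?_
  · refine hb.injective ?_
    ext w
    simpa using hv (w, 0)
  · refine hk.injective ?_
    ext w
    simpa [hf] using hv (0, w)

theorem christoffel_warpedLocal [FiniteDimensional ℝ B] [FiniteDimensional ℝ E]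
    {b : B → B →L[ℝ] B →L[ℝ] ℝ} {f : B → ℝ}
    {k : E → E →L[ℝ] E →L[ℝ] ℝ} {z : B × E} (hb : ContDiffAt ℝ 1 b z.1)
    (hf : ContDiffAt ℝ 1 f z.1) (hk : ContDiffAt ℝ 1 k z.2)
    (hb' : (b z.1).IsInvertible) (hf' : f z.1 ≠ 0) (hk' : (k z.2).IsInvertible) (v w : B × E) :
    christoffel (warpedLocal b f k) z v w =
      (christoffel b z.1 v.1 w.1 - (f z.1 * k z.2 v.2 w.2) • gradLocal b f z.1,
        christoffel k z.2 v.2 w.2 + (fderiv ℝ f z.1 v.1 / f z.1) • w.2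
          + (fderiv ℝ f z.1 w.1 / f z.1) • v.2) := by
  refine christoffel_eq_of_apply (isInvertible_warpedLocal hb' hf' hk') fun u => ?_
  have hg : b z.1 (gradLocal b f z.1) u.1 = fderiv ℝ f z.1 u.1 := by
    rw [gradLocal, hb'.self_apply_inverse]
  rw [christoffelFirst_apply, warpedLocal_apply]
  simp only [fderiv_warpedLocal_apply hb hf hk, map_sub, map_add, map_smul, sub_apply, add_apply,
    smul_apply, apply_christoffel hb', apply_christoffel hk', christoffelFirst_apply, hg,
    smul_eq_mul]
  field_simp
  ring

end Warped

/-! ### Ricci tensor and Hessian of a warped product. -/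

section WarpedCurvature

theorem eventually_isInvertible {X E F : Type*} [TopologicalSpace X]
    [NormedAddCommGroup E] [NormedSpace ℝ E] [NormedAddCommGroup F] [NormedSpace ℝ F]
    [CompleteSpace E] {T : X → E →L[ℝ] F} {x : X} (hT : ContinuousAt T x)
    (hi : (T x).IsInvertible) : ∀ᶠ y in 𝓝 x, (T y).IsInvertible := by
  obtain ⟨A, hA⟩ := hi
  exact hT.eventually (hA ▸ ContinuousLinearEquiv.nhds A)

variable {B E : Type*} [NormedAddCommGroup B] [NormedSpace ℝ B]
  [NormedAddCommGroup E] [NormedSpace ℝ E] [FiniteDimensional ℝ B] [FiniteDimensional ℝ E]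
  {b : B → B →L[ℝ] B →L[ℝ] ℝ} {f : B → ℝ} {k : E → E →L[ℝ] E →L[ℝ] ℝ} {z : B × E}

/-- The pointwise formula is to be differentiated, so it is needed on a neighbourhood; its
hypotheses are open conditions. -/
theorem eventually_christoffel_warpedLocal (hb : ContDiffAt ℝ ∞ b z.1)
    (hf : ContDiffAt ℝ ∞ f z.1) (hk : ContDiffAt ℝ ∞ k z.2)
    (hb' : (b z.1).IsInvertible) (hf' : f z.1 ≠ 0) (hk' : (k z.2).IsInvertible) (v w : B × E) :
    (fun x => christoffel (warpedLocal b f k) x v w) =ᶠ[𝓝 z] fun x =>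
      (christoffel b x.1 v.1 w.1 - (f x.1 * k x.2 v.2 w.2) • gradLocal b f x.1,
        christoffel k x.2 v.2 w.2 + (fderiv ℝ f x.1 v.1 / f x.1) • w.2
          + (fderiv ℝ f x.1 w.1 / f x.1) • v.2) := by
  have := FiniteDimensional.complete ℝ B
  have := FiniteDimensional.complete ℝ E
  have c1 : Tendsto (Prod.fst : B × E → B) (𝓝 z) (𝓝 z.1) := continuousAt_fst
  have c2 : Tendsto (Prod.snd : B × E → E) (𝓝 z) (𝓝 z.2) := continuousAt_snd
  filter_upwards [c1.eventually ((hb.of_le (m := 1) (by simp)).eventually (by simp)),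
    c1.eventually ((hf.of_le (m := 1) (by simp)).eventually (by simp)),
    c2.eventually ((hk.of_le (m := 1) (by simp)).eventually (by simp)),
    c1.eventually (eventually_isInvertible hb.continuousAt hb'),
    c1.eventually (hf.continuousAt.eventually_ne hf'),
    c2.eventually (eventually_isInvertible hk.continuousAt hk')] with x h1 h2 h3 h4 h5 h6
  exact christoffel_warpedLocal h1 h2 h3 h4 h5 h6 v w

theorem fderiv_christoffel_warpedLocal (hb : ContDiffAt ℝ ∞ b z.1)
    (hf : ContDiffAt ℝ ∞ f z.1) (hk : ContDiffAt ℝ ∞ k z.2)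
    (hb' : (b z.1).IsInvertible) (hf' : f z.1 ≠ 0) (hk' : (k z.2).IsInvertible) (u v w : B × E) :
    fderiv ℝ (christoffel (warpedLocal b f k)) z u v w =
      (fderiv ℝ (christoffel b) z.1 u.1 v.1 w.1
        - (fderiv ℝ f z.1 u.1 * k z.2 v.2 w.2 + f z.1 * fderiv ℝ k z.2 u.2 v.2 w.2) •
          gradLocal b f z.1
        - (f z.1 * k z.2 v.2 w.2) • fderiv ℝ (gradLocal b f) z.1 u.1,
      fderiv ℝ (christoffel k) z.2 u.2 v.2 w.2
        + (fderiv ℝ (fderiv ℝ f) z.1 u.1 v.1 / f z.1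
          - fderiv ℝ f z.1 u.1 * fderiv ℝ f z.1 v.1 / f z.1 ^ 2) • w.2
        + (fderiv ℝ (fderiv ℝ f) z.1 u.1 w.1 / f z.1
          - fderiv ℝ f z.1 u.1 * fderiv ℝ f z.1 w.1 / f z.1 ^ 2) • v.2) := by
  have := FiniteDimensional.complete ℝ B
  have := FiniteDimensional.complete ℝ E
  have p1 := hasFDerivAt_fst (𝕜 := ℝ) (p := z)
  have p2 := hasFDerivAt_snd (𝕜 := ℝ) (p := z)
  have h1 := hasFDerivAt_clm_apply₂ ((contDiffAt_christoffel
    (contDiffAt_warpedLocal hb hf hk) (isInvertible_warpedLocal hb' hf' hk')).differentiableAt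
      (by simp)) v w
  have h2 := (hasFDerivAt_clm_apply₂ ((contDiffAt_christoffel hb hb').differentiableAt
    (by simp)) v.1 w.1).comp z p1
  have h3 := (hf.differentiableAt (by simp)).hasFDerivAt.comp z p1
  have h4 := (hasFDerivAt_clm_apply₂ (hk.differentiableAt (by simp)) v.2 w.2).comp z p2
  have h5 := ((contDiffAt_gradLocal hb hb' hf).differentiableAt (by simp)).hasFDerivAt.comp z p1
  have h6 := (hasFDerivAt_clm_apply₂ ((contDiffAt_christoffel hk hk').differentiableAt
    (by simp)) v.2 w.2).comp z p2
  have hdf : DifferentiableAt ℝ (fderiv ℝ f) z.1 :=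
    (hf.fderiv_right (m := ∞) (by simp)).differentiableAt (by simp)
  have h7 : ∀ a : B, HasFDerivAt (fun x : B × E => fderiv ℝ f x.1 a / f x.1)
      ((f z.1)⁻¹ • ((fderiv ℝ (fderiv ℝ f) z.1).flip a ∘L ContinuousLinearMap.fst ℝ B E) -
        (fderiv ℝ f z.1 a / f z.1 ^ 2) • (fderiv ℝ f z.1 ∘L ContinuousLinearMap.fst ℝ B E)) z := by
    intro a
    have h8 := (hdf.hasFDerivAt.clm_apply (hasFDerivAt_const a z.1)).comp z p1
    have h9 := h8.mul ((hasDerivAt_inv hf').comp_hasFDerivAt z h3)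
    refine (h9.congr_fderiv ?_)
    refine ContinuousLinearMap.ext fun x => ?_
    simp
    field_simp
    ring
  have e := h1.unique (HasFDerivAt.congr_of_eventuallyEq
    (((h2.sub ((h3.mul h4).smul h5)).prodMk
      ((h6.add ((h7 v.1).smul_const w.2)).add ((h7 w.1).smul_const v.2))))
    (eventually_christoffel_warpedLocal hb hf hk hb' hf' hk' v w))
  have e1 := DFunLike.congr_fun e u
  simp only [ContinuousLinearMap.flip_apply] at e1
  rw [e1]
  refine Prod.ext ?_ ?_
  · simp
    module
  · simp
    module

/-- The base block of the curvature operator is that of `b` minus a multiple of the Hessian of `f`.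
The fibre block is that of `k`, minus a multiple of the identity (trace `m`), plus a rank-one term;
the latter turns `m` into `m - 1` in front of |∇f|². -/
theorem ricciLocal_warpedLocal (hb : ContDiffAt ℝ ∞ b z.1)
    (hf : ContDiffAt ℝ ∞ f z.1) (hk : ContDiffAt ℝ ∞ k z.2)
    (hb' : (b z.1).IsInvertible) (hf' : f z.1 ≠ 0) (hk' : (k z.2).IsInvertible)
    (hs : ∀ y v w, k y v w = k y w v) (v w : B × E) :
    ricciLocal (warpedLocal b f k) z v w =
      ricciLocal b z.1 v.1 w.1
        - Module.finrank ℝ E / f z.1 * hessLocal b f z.1 v.1 w.1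
        + ricciLocal k z.2 v.2 w.2
        - (f z.1 * LinearMap.trace ℝ B (hessOp b f z.1) +
          (Module.finrank ℝ E - 1) * fderiv ℝ f z.1 (gradLocal b f z.1)) * k z.2 v.2 w.2 := by
  have hc := christoffel_warpedLocal (hb.of_le (m := 1) (by simp)) (hf.of_le (m := 1) (by simp))
    (hk.of_le (m := 1) (by simp)) hb' hf' hk'
  have hd := fderiv_christoffel_warpedLocal hb hf hk hb' hf' hk'
  have e1 : LinearMap.fst ℝ B E ∘ₗ curvatureOp (warpedLocal b f k) z v w ∘ₗ LinearMap.inl ℝ B E =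
      curvatureOp b z.1 v.1 w.1 - (f z.1 * k z.2 v.2 w.2) • (hessOp b f z.1 : B →ₗ[ℝ] B) := by
    ext x
    simp [curvatureOp, hc, hd, hessOp_apply]
    match_scalars <;> field_simp <;> ring
  have e2 : LinearMap.snd ℝ B E ∘ₗ curvatureOp (warpedLocal b f k) z v w ∘ₗ LinearMap.inr ℝ B E =
      curvatureOp k z.2 v.2 w.2
        - (hessLocal b f z.1 v.1 w.1 / f z.1 + k z.2 v.2 w.2 * fderiv ℝ f z.1 (gradLocal b f z.1)) •
          LinearMap.id
        + fderiv ℝ f z.1 (gradLocal b f z.1) •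
          (((k z.2).flip w.2 : E →L[ℝ] ℝ) : E →ₗ[ℝ] ℝ).smulRight v.2 := by
    ext x
    -- The warping leaves (df(w)/f)(Γ(x, v) - Γ(v, x)) in the fibre, which vanishes because the
    -- connection is torsion-free.
    have := christoffel_symm (hk.differentiableAt (by simp)) hs x v.2
    simp [curvatureOp, hc, hd, hessLocal, this]
    match_scalars <;> field_simp <;> ring
  rw [ricciLocal, trace_prod_eq, e1, e2]
  simp only [map_sub, map_add, map_smul, LinearMap.trace_id, LinearMap.trace_smulRight, ricciLocal,
    smul_eq_mul]
  simp
  field_simp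
  ring

/-- Only the base component of Γ acts on `u`; its term -f k(v, w) ∇f produces the fibre
contribution. -/
theorem hessLocal_warpedLocal {u : B → ℝ} (hb : ContDiffAt ℝ ∞ b z.1)
    (hf : ContDiffAt ℝ ∞ f z.1) (hk : ContDiffAt ℝ ∞ k z.2)
    (hb' : (b z.1).IsInvertible) (hf' : f z.1 ≠ 0) (hk' : (k z.2).IsInvertible)
    (hu : ContDiff ℝ ∞ u) (v w : B × E) :
    hessLocal (warpedLocal b f k) (fun x => u x.1) z v w =
      hessLocal b u z.1 v.1 w.1 +
        f z.1 * fderiv ℝ u z.1 (gradLocal b f z.1) * k z.2 v.2 w.2 := by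
  have hc := christoffel_warpedLocal (hb.of_le (m := 1) (by simp)) (hf.of_le (m := 1) (by simp))
    (hk.of_le (m := 1) (by simp)) hb' hf' hk'
  have h1 : fderiv ℝ (fun x : B × E => u x.1) =
      fun x => fderiv ℝ u x.1 ∘L ContinuousLinearMap.fst ℝ B E := by
    ext1 x
    exact ((hu.differentiable (by simp) x.1).hasFDerivAt.comp x hasFDerivAt_fst).fderiv
  have hdu : DifferentiableAt ℝ (fderiv ℝ u) z.1 :=
    (hu.fderiv_right (m := ∞) (by simp)).differentiable (by simp) z.1
  have h2 := (hdu.hasFDerivAt.comp z (hasFDerivAt_fst (𝕜 := ℝ))).clm_comp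
    (hasFDerivAt_const (ContinuousLinearMap.fst ℝ B E) z)
  have h3 : fderiv ℝ (fun x : B × E => fderiv ℝ u x.1 ∘L ContinuousLinearMap.fst ℝ B E) z v w =
    fderiv ℝ (fderiv ℝ u) z.1 v.1 w.1 := by
    have := h2.fderiv
    simp only [Function.comp_def] at this
    rw [this]
    simp
  rw [hessLocal, hessLocal, h1, h3, hc]
  simp
  ring

end WarpedCurvature

/-! ### Curvature, Hessian and Laplacian of a metric conformal to a constant one. -/

section ConformallyFlat

variable {B : Type*} [NormedAddCommGroup B] [NormedSpace ℝ B]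

/-- The metric `φ⁻² P` on the vector space `B`, where `P` is a constant metric. -/
def conformalLocal (P : B →L[ℝ] B →L[ℝ] ℝ) (φ : B → ℝ) (x : B) : B →L[ℝ] B →L[ℝ] ℝ :=
  (1 / φ x ^ 2) • P

variable {P : B →L[ℝ] B →L[ℝ] ℝ} {φ f : B → ℝ}

theorem contDiff_conformalLocal (hφ : ContDiff ℝ ∞ φ) (hφ' : ∀ x, φ x ≠ 0) :
    ContDiff ℝ ∞ (conformalLocal P φ) :=
  (contDiff_const.div (hφ.pow 2) fun x => pow_ne_zero 2 (hφ' x)).smul contDiff_const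

variable [FiniteDimensional ℝ B]

theorem isInvertible_conformalLocal (hP : P.IsInvertible) (hφ' : ∀ x, φ x ≠ 0) (x : B) :
    (conformalLocal P φ x).IsInvertible := by
  refine isInvertible_of_nondegenerate fun v hv => ?_
  refine hP.injective ?_
  ext w
  simpa [conformalLocal, hφ' x] using hv w

theorem gradLocal_conformalLocal (hP : P.IsInvertible) (hφ' : ∀ x, φ x ≠ 0) (x : B) :
    gradLocal (conformalLocal P φ) f x = φ x ^ 2 • P.inverse (fderiv ℝ f x) := by
  have h : fderiv ℝ f x = conformalLocal P φ x (φ x ^ 2 • P.inverse (fderiv ℝ f x)) := by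
    ext w
    simp [conformalLocal, hP.self_apply_inverse, hφ' x]
  rw [gradLocal]
  conv_lhs => rw [h]
  rw [(isInvertible_conformalLocal hP hφ' x).inverse_apply_self]

omit [FiniteDimensional ℝ B] in
theorem fderiv_conformalLocal_apply (hφ : ContDiff ℝ ∞ φ) (hφ' : ∀ x, φ x ≠ 0) (x u v w : B) :
    fderiv ℝ (conformalLocal P φ) x u v w = -(2 * fderiv ℝ φ x u / φ x ^ 3) * P v w := by
  have h1 := (hφ.differentiable (by simp) x).hasFDerivAt
  have h2 := ((hasDerivAt_inv (pow_ne_zero 2 (hφ' x))).comp_hasFDerivAt x (h1.pow 2)).smul_const P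
  have e : conformalLocal P φ = fun x => (φ x ^ 2)⁻¹ • P := by
    ext x; simp [conformalLocal]
  have h3 := h2.fderiv
  simp only [Function.comp_def] at h3
  rw [e, h3]
  have := hφ' x
  simp
  field_simp
  simp

theorem christoffel_conformalLocal (hP : P.IsInvertible) (hs : ∀ v w, P v w = P w v)
    (hφ : ContDiff ℝ ∞ φ) (hφ' : ∀ x, φ x ≠ 0) (x v w : B) :
    christoffel (conformalLocal P φ) x v w =
      (φ x)⁻¹ • (P v w • P.inverse (fderiv ℝ φ x) - fderiv ℝ φ x v • w - fderiv ℝ φ x w • v) := by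
  refine christoffel_eq_of_apply (isInvertible_conformalLocal hP hφ' x) fun u => ?_
  have := hφ' x
  rw [christoffelFirst_apply]
  simp only [fderiv_conformalLocal_apply hφ hφ']
  simp [conformalLocal, hP.self_apply_inverse]
  rw [hs v u, hs w u, hs u v, hs u w]
  field_simp
  ring

omit [FiniteDimensional ℝ B] in
theorem hasFDerivAt_inverse_fderiv (hf : ContDiff ℝ ∞ f) (x : B) :
    HasFDerivAt (fun x => P.inverse (fderiv ℝ f x)) (P.inverse ∘L fderiv ℝ (fderiv ℝ f) x) x :=
  P.inverse.hasFDerivAt.comp x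
    ((hf.fderiv_right (m := ∞) (by simp)).differentiable (by simp) x).hasFDerivAt

theorem fderiv_christoffel_conformalLocal (hP : P.IsInvertible) (hs : ∀ v w, P v w = P w v)
    (hφ : ContDiff ℝ ∞ φ) (hφ' : ∀ x, φ x ≠ 0) (x u v w : B) :
    fderiv ℝ (christoffel (conformalLocal P φ)) x u v w =
      (φ x)⁻¹ • (P v w • P.inverse (fderiv ℝ (fderiv ℝ φ) x u)
        - fderiv ℝ (fderiv ℝ φ) x u v • w - fderiv ℝ (fderiv ℝ φ) x u w • v)
      - (fderiv ℝ φ x u / φ x ^ 2) •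
        (P v w • P.inverse (fderiv ℝ φ x) - fderiv ℝ φ x v • w - fderiv ℝ φ x w • v) := by
  have := FiniteDimensional.complete ℝ B
  have h1 := hasFDerivAt_clm_apply₂ ((contDiffAt_christoffel
    (contDiff_conformalLocal (P := P) hφ hφ').contDiffAt
      (isInvertible_conformalLocal hP hφ' x)).differentiableAt (by simp)) v w
  have h2 := (hφ.differentiable (by simp) x).hasFDerivAt
  have h3 : ∀ a, HasFDerivAt (fun x => fderiv ℝ φ x a) ((fderiv ℝ (fderiv ℝ φ) x).flip a) x := by
    intro a
    exact (((hφ.fderiv_right (m := ∞) (by simp)).differentiable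
      (by simp) x).hasFDerivAt.clm_apply (hasFDerivAt_const a x)).congr_fderiv (by ext; simp)
  have h4 := ((hasDerivAt_inv (hφ' x)).comp_hasFDerivAt x h2).smul
    ((((hasFDerivAt_inverse_fderiv (P := P) hφ x).const_smul (P v w)).sub
      ((h3 v).smul_const w)).sub ((h3 w).smul_const v))
  simp only [christoffel_conformalLocal hP hs hφ hφ'] at h1
  have e1 := DFunLike.congr_fun (h1.unique h4) u
  simp only [ContinuousLinearMap.flip_apply] at e1
  rw [e1]
  simp
  module

omit [FiniteDimensional ℝ B] in
theorem fderiv_fderiv_symm (hf : ContDiff ℝ ∞ f) (x v w : B) :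
    fderiv ℝ (fderiv ℝ f) x v w = fderiv ℝ (fderiv ℝ f) x w v :=
  (hf.contDiffAt.isSymmSndFDerivAt (by simpa using ENat.LEInfty.out)).eq v w

omit [FiniteDimensional ℝ B] in
theorem fderiv_inverse_comm (hP : P.IsInvertible) (hs : ∀ v w, P v w = P w v)
    (α β : B →L[ℝ] ℝ) : α (P.inverse β) = β (P.inverse α) := by
  conv_lhs => rw [← hP.self_apply_inverse α]
  rw [hs, hP.self_apply_inverse]

/-- The curvature operator combines the identity, P⁻¹D²φ and three rank-one maps. Two of these each
have trace D²φ(v, w)/φ, lowering `n` to `n - 2`; the third lowers `n` to `n - 1` in front of |dφ|².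
-/
theorem ricciLocal_conformalLocal (hP : P.IsInvertible) (hs : ∀ v w, P v w = P w v)
    (hφ : ContDiff ℝ ∞ φ) (hφ' : ∀ x, φ x ≠ 0) (x v w : B) :
    ricciLocal (conformalLocal P φ) x v w =
      (Module.finrank ℝ B - 2) * fderiv ℝ (fderiv ℝ φ) x v w / φ x +
      P v w / φ x ^ 2 *
        (φ x * LinearMap.trace ℝ B (P.inverse ∘L fderiv ℝ (fderiv ℝ φ) x : B →L[ℝ] B) -
          (Module.finrank ℝ B - 1) * fderiv ℝ φ x (P.inverse (fderiv ℝ φ x))) := by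
  have := hφ' x
  have e : curvatureOp (conformalLocal P φ) x v w =
      (fderiv ℝ (fderiv ℝ φ) x v w / φ x -
        fderiv ℝ φ x (P.inverse (fderiv ℝ φ x)) * P v w / φ x ^ 2) • LinearMap.id
      + (P v w / φ x) • ((P.inverse ∘L fderiv ℝ (fderiv ℝ φ) x : B →L[ℝ] B) : B →ₗ[ℝ] B)
      - (((fderiv ℝ (fderiv ℝ φ) x).flip w : B →L[ℝ] ℝ) : B →ₗ[ℝ] ℝ).smulRight ((φ x)⁻¹ • v)
      - ((P.flip w : B →L[ℝ] ℝ) : B →ₗ[ℝ] ℝ).smulRight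
        ((φ x)⁻¹ • P.inverse (fderiv ℝ (fderiv ℝ φ) x v))
      + ((P.flip w : B →L[ℝ] ℝ) : B →ₗ[ℝ] ℝ).smulRight
        ((fderiv ℝ φ x (P.inverse (fderiv ℝ φ x)) / φ x ^ 2) • v) := by
    ext z
    simp [curvatureOp, christoffel_conformalLocal hP hs hφ hφ',
      fderiv_christoffel_conformalLocal hP hs hφ hφ', hs z (P.inverse _), hs v (P.inverse _),
      hP.self_apply_inverse, fderiv_fderiv_symm hφ x z v, hs z v]
    match_scalars <;> field_simp <;> ring
  rw [ricciLocal, e]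
  simp only [map_sub, map_add, map_smul, LinearMap.trace_id, LinearMap.trace_smulRight,
    smul_eq_mul]
  simp [hP.self_apply_inverse]
  field_simp
  ring

theorem hessLocal_conformalLocal (hP : P.IsInvertible) (hs : ∀ v w, P v w = P w v)
    (hφ : ContDiff ℝ ∞ φ) (hφ' : ∀ x, φ x ≠ 0) (x v w : B) :
    hessLocal (conformalLocal P φ) f x v w = fderiv ℝ (fderiv ℝ f) x v w +
      (fderiv ℝ φ x v * fderiv ℝ f x w + fderiv ℝ φ x w * fderiv ℝ f x v -
        P v w * fderiv ℝ φ x (P.inverse (fderiv ℝ f x))) / φ x := by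
  have := hφ' x
  rw [hessLocal, christoffel_conformalLocal hP hs hφ hφ',
    fderiv_inverse_comm hP hs (fderiv ℝ φ x)]
  simp
  field_simp
  ring

/-- This is the Laplacian of `f` for φ⁻²P: two rank-one terms and `-n` from the identity give the
coefficient `-(n - 2)`. -/
theorem trace_hessOp_conformalLocal (hP : P.IsInvertible) (hs : ∀ v w, P v w = P w v)
    (hφ : ContDiff ℝ ∞ φ) (hφ' : ∀ x, φ x ≠ 0) (hf : ContDiff ℝ ∞ f) (x : B) :
    LinearMap.trace ℝ B (hessOp (conformalLocal P φ) f x) =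
      φ x ^ 2 * LinearMap.trace ℝ B (P.inverse ∘L fderiv ℝ (fderiv ℝ f) x : B →L[ℝ] B) -
        (Module.finrank ℝ B - 2) * φ x * fderiv ℝ φ x (P.inverse (fderiv ℝ f x)) := by
  have := hφ' x
  have h1 := ((hφ.differentiable (by simp) x).hasFDerivAt.pow 2).smul
    (hasFDerivAt_inverse_fderiv (P := P) hf x)
  have h2 : gradLocal (conformalLocal P φ) f = (fun x => φ x ^ 2) • fun x => P.inverse (fderiv ℝ f x) :=
    funext fun x => gradLocal_conformalLocal hP hφ' x
  have e : (hessOp (conformalLocal P φ) f x : B →ₗ[ℝ] B) =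
      (φ x ^ 2) • ((P.inverse ∘L fderiv ℝ (fderiv ℝ f) x : B →L[ℝ] B) : B →ₗ[ℝ] B)
      + ((fderiv ℝ φ x : B →L[ℝ] ℝ) : B →ₗ[ℝ] ℝ).smulRight
        (φ x • P.inverse (fderiv ℝ f x))
      - (φ x * fderiv ℝ φ x (P.inverse (fderiv ℝ f x))) • LinearMap.id
      + ((fderiv ℝ f x : B →L[ℝ] ℝ) : B →ₗ[ℝ] ℝ).smulRight
        (φ x • P.inverse (fderiv ℝ φ x)) := by
    ext z
    rw [ContinuousLinearMap.coe_coe, hessOp_apply, h2, h1.fderiv,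
      christoffel_conformalLocal hP hs hφ hφ']
    simp [hs z (P.inverse _), hP.self_apply_inverse]
    match_scalars <;> field_simp <;> ring
  rw [e]
  simp only [map_sub, map_add, map_smul, LinearMap.trace_id, LinearMap.trace_smulRight,
    smul_eq_mul]
  simp [fderiv_inverse_comm hP hs (fderiv ℝ f x)]
  ring

end ConformallyFlat

/-! ### Passage from chart formulas to the manifold. -/

section Congr

variable {E : Type*} [NormedAddCommGroup E] [NormedSpace ℝ E]
  {G G' : E → E →L[ℝ] E →L[ℝ] ℝ}
  {y : E}

theorem christoffel_eventuallyEq (h : G =ᶠ[𝓝 y] G') : christoffel G =ᶠ[𝓝 y] christoffel G' := by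
  have h' : fderiv ℝ G =ᶠ[𝓝 y] fderiv ℝ G' := Filter.EventuallyEq.fderiv (𝕜 := ℝ) h
  filter_upwards [h, h'] with x h1 h2
  rw [christoffel, christoffel, christoffelFirst, christoffelFirst, h1, h2]

/-- Ricci depends only on the germ of the metric, so agreement on the chart target suffices. -/
theorem ricciLocal_congr (h : G =ᶠ[𝓝 y] G') (v w : E) :
    ricciLocal G y v w = ricciLocal G' y v w := by
  have h1 := christoffel_eventuallyEq h
  rw [ricciLocal, ricciLocal]
  congr 1
  ext z
  simp only [curvatureOp, LinearMap.coe_mk, AddHom.coe_mk, h1.fderiv_eq, h1.eq_of_nhds]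

theorem hessLocal_congr (h : G =ᶠ[𝓝 y] G') (u : E → ℝ) (v w : E) :
    hessLocal G u y v w = hessLocal G' u y v w := by
  rw [hessLocal, hessLocal, (christoffel_eventuallyEq h).eq_of_nhds]

end Congr

theorem eq_zero_of_add_mul_eq_zero {B E : Type*} [NormedAddCommGroup B] [NormedSpace ℝ B]
    [NormedAddCommGroup E] [NormedSpace ℝ E] {b : B →L[ℝ] B →L[ℝ] ℝ} {k : E →L[ℝ] E →L[ℝ] ℝ}
    {c : ℝ} (hc : c ≠ 0) (hb : ∀ v, (∀ w, b v w = 0) → v = 0)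
    (hk : ∀ v, (∀ w, k v w = 0) → v = 0) (v : B × E)
    (h : ∀ w : B × E, b v.1 w.1 + c * k v.2 w.2 = 0) : v = 0 := by
  refine Prod.ext (hb _ fun w => ?_) (hk _ fun w => ?_)
  · simpa using h (w, 0)
  · simpa [hc] using h (0, w)

section TensorChart

variable {E : Type*} [NormedAddCommGroup E] [NormedSpace ℝ E]
  {H : Type*} [TopologicalSpace H] (I : ModelWithCorners ℝ E H)
  {M : Type*} [TopologicalSpace M] [ChartedSpace H M] [IsManifold I ∞ M]

theorem ricci_apply (g : TensorField₂ I M) (p : M) (v w : E) :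
    ricci I g p v w = ricciLocal (inChart I g p) (extChartAt I p p) v w := by
  have h1 := chartDiff_apply I p v
  have h2 := chartDiff_apply I p w
  exact congrArg₂ (ricciLocal (inChart I g p) (extChartAt I p p)) h1 h2

theorem hess_apply (g : TensorField₂ I M) (u : M → ℝ) (p : M) (v w : E) :
    hess I g u p v w =
      hessLocal (inChart I g p) (u ∘ (extChartAt I p).symm) (extChartAt I p p) v w := by
  have h1 := chartDiff_apply I p v
  have h2 := chartDiff_apply I p w
  exact congrArg₂ (hessLocal (inChart I g p) (u ∘ (extChartAt I p).symm) (extChartAt I p p)) h1 h2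

end TensorChart

/-! ### Ricci tensor and Hessian of the warped product manifold. -/

section WarpedManifold

variable {B E : Type*} [NormedAddCommGroup B] [NormedSpace ℝ B]
  [NormedAddCommGroup E] [NormedSpace ℝ E]
  {H : Type*} [TopologicalSpace H] (J : ModelWithCorners ℝ E H)
  {F : Type*} [TopologicalSpace F] [ChartedSpace H F] [IsManifold J ∞ F] [J.Boundaryless]
  {b : B → B →L[ℝ] B →L[ℝ] ℝ} {f : B → ℝ} {gF : TensorField₂ J F}

omit [IsManifold J ∞ F] [J.Boundaryless] in
theorem extChartAt_warped_self (p : B × F) :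
    extChartAt (𝓘(ℝ, B).prod J) p p = (p.1, extChartAt J p.2 p.2) := by
  rw [extChartAt_prod]
  rfl

variable (b f gF) in
theorem eventually_inChart_warpedMetric (p : B × F) :
    inChart (𝓘(ℝ, B).prod J) (warpedMetric 𝓘(ℝ, B) J b f gF) p
      =ᶠ[𝓝 (p.1, extChartAt J p.2 p.2)] warpedLocal b f (inChart J gF p.2) := by
  have c2 : Tendsto (Prod.snd : B × E → E) (𝓝 (p.1, extChartAt J p.2 p.2))
    (𝓝 (extChartAt J p.2 p.2)) := continuousAt_snd
  filter_upwards [c2.eventually (extChartAt_target_mem_nhds (I := J) p.2)] with z hz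
  exact inChart_warpedMetric J b f gF p z hz

theorem isSemiRiemannian_warpedMetric (hb : ContDiff ℝ ∞ b) (hf : ContDiff ℝ ∞ f)
    (hgF : IsSemiRiemannian J gF) (hb' : ∀ x, (b x).IsInvertible) (hf' : ∀ x, f x ≠ 0)
    (hs : ∀ x v w, b x v w = b x w v) :
    IsSemiRiemannian (𝓘(ℝ, B).prod J) (warpedMetric 𝓘(ℝ, B) J b f gF) where
  symm p v w := by
    refine (warpedMetric_apply J b f gF p v w).trans
      (Eq.trans ?_ (warpedMetric_apply J b f gF p w v).symm)
    exact congrArg₂ (fun s t => s + f p.1 ^ 2 * t) (hs p.1 v.1 w.1) (hgF.symm p.2 v.2 w.2)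
  nondegenerate p v hv := by
    have hb0 : ∀ x v, (∀ w, b x v w = 0) → v = 0 := fun x v h =>
      (hb' x).injective (ContinuousLinearMap.ext fun w => by simp [h w])
    exact eq_zero_of_add_mul_eq_zero (B := B) (E := E) (b := b p.1) (k := gF p.2) (pow_ne_zero 2 (hf' p.1)) (hb0 p.1)
      (hgF.nondegenerate p.2) v fun w => (warpedMetric_apply J b f gF p v w).symm.trans (hv w)
  smooth p := by
    refine (contMDiffAt_tensorField_iff (𝓘(ℝ, B).prod J) _ p).2 ?_
    rw [extChartAt_warped_self]
    exact (contDiffAt_warpedLocal hb.contDiffAt hf.contDiffAt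
      (hgF.contDiffAt_inChart J p.2)).congr_of_eventuallyEq
        (eventually_inChart_warpedMetric J b f gF p)

variable [FiniteDimensional ℝ B] [FiniteDimensional ℝ E]

theorem ricci_warpedMetric (hb : ContDiff ℝ ∞ b) (hf : ContDiff ℝ ∞ f)
    (hgF : IsSemiRiemannian J gF) (hb' : ∀ x, (b x).IsInvertible) (hf' : ∀ x, f x ≠ 0)
    (p : B × F) (v w : B × E) :
    ricci (𝓘(ℝ, B).prod J) (warpedMetric 𝓘(ℝ, B) J b f gF) p v w =
      ricciLocal b p.1 v.1 w.1
        - Module.finrank ℝ E / f p.1 * hessLocal b f p.1 v.1 w.1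
        + ricci J gF p.2 v.2 w.2
        - (f p.1 * LinearMap.trace ℝ B (hessOp b f p.1) +
          (Module.finrank ℝ E - 1) * fderiv ℝ f p.1 (gradLocal b f p.1)) *
          gF p.2 v.2 w.2 := by
  have hk : (inChart J gF p.2 (extChartAt J p.2 p.2)).IsInvertible :=
    isInvertible_of_nondegenerate (hgF.inChart_nondegenerate J p.2 (mem_extChartAt_target p.2))
  have h1 := ricciLocal_warpedLocal (z := (p.1, extChartAt J p.2 p.2)) hb.contDiffAt hf.contDiffAt
    (hgF.contDiffAt_inChart J p.2) (hb' p.1) (hf' p.1) hk (hgF.inChart_symm J p.2) v w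
  rw [inChart_self_apply, ← ricci_apply] at h1
  refine (ricci_apply (𝓘(ℝ, B).prod J) _ p v w).trans (Eq.trans ?_ h1)
  rw [extChartAt_warped_self]
  exact ricciLocal_congr (eventually_inChart_warpedMetric J b f gF p) v w

theorem hess_warpedMetric {u : B → ℝ} (hb : ContDiff ℝ ∞ b) (hf : ContDiff ℝ ∞ f)
    (hgF : IsSemiRiemannian J gF) (hb' : ∀ x, (b x).IsInvertible) (hf' : ∀ x, f x ≠ 0)
    (hu : ContDiff ℝ ∞ u) (p : B × F) (v w : B × E) :
    hess (𝓘(ℝ, B).prod J) (warpedMetric 𝓘(ℝ, B) J b f gF) (fun p : B × F => u p.1) p v w =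
      hessLocal b u p.1 v.1 w.1 +
        f p.1 * fderiv ℝ u p.1 (gradLocal b f p.1) * gF p.2 v.2 w.2 := by
  have hk : (inChart J gF p.2 (extChartAt J p.2 p.2)).IsInvertible :=
    isInvertible_of_nondegenerate (hgF.inChart_nondegenerate J p.2 (mem_extChartAt_target p.2))
  have h1 := hessLocal_warpedLocal (z := (p.1, extChartAt J p.2 p.2)) hb.contDiffAt hf.contDiffAt
    (hgF.contDiffAt_inChart J p.2) (hb' p.1) (hf' p.1) hk hu v w
  have h2 : (fun p : B × F => u p.1) ∘ (extChartAt (𝓘(ℝ, B).prod J) p).symm =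
      fun z : B × E => u z.1 := by
    rw [extChartAt_prod]
    rfl
  rw [inChart_self_apply] at h1
  refine (hess_apply (𝓘(ℝ, B).prod J) _ _ p v w).trans (Eq.trans ?_ h1)
  rw [extChartAt_warped_self, h2]
  exact hessLocal_congr (eventually_inChart_warpedMetric J b f gF p) _ v w

end WarpedManifold

/-! ### Pseudo-Euclidean coordinates. -/

section PseudoEuclideanCoordinates

variable {n : ℕ} {ε : Fin n → ℝ}

theorem pseudoForm_symm (v w : EuclideanSpace ℝ (Fin n)) :
    pseudoForm ε v w = pseudoForm ε w v := by
  simp only [pseudoForm_apply]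
  exact Finset.sum_congr rfl fun i _ => by ring

theorem pseudoForm_single (i : Fin n) (w : EuclideanSpace ℝ (Fin n)) :
    pseudoForm ε (EuclideanSpace.single i 1) w = ε i * w i := by
  simp [pseudoForm_apply]

theorem isInvertible_pseudoForm (hε : ∀ i, ε i = 1 ∨ ε i = -1) : (pseudoForm ε).IsInvertible := by
  refine isInvertible_of_nondegenerate fun v hv => ?_
  ext i
  have h := hv (EuclideanSpace.single i 1)
  rw [pseudoForm_symm, pseudoForm_single] at h
  rcases hε i with h1 | h1 <;> simpa [h1] using h

theorem sq_eq_one_of_sign (hε : ∀ i, ε i = 1 ∨ ε i = -1) (i : Fin n) : ε i * ε i = 1 := by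
  rcases hε i with h | h <;> simp [h]

theorem inverse_pseudoForm_apply (hε : ∀ i, ε i = 1 ∨ ε i = -1)
    (α : EuclideanSpace ℝ (Fin n) →L[ℝ] ℝ) (i : Fin n) :
    (pseudoForm ε).inverse α i = ε i * α (EuclideanSpace.single i 1) := by
  have h := DFunLike.congr_fun ((isInvertible_pseudoForm hε).self_apply_inverse α)
    (EuclideanSpace.single i 1)
  rw [pseudoForm_symm, pseudoForm_single] at h
  rw [← h, ← mul_assoc, sq_eq_one_of_sign hε, one_mul]

/-- Since ε_k² = 1, the diagonal matrix of the form is its own inverse. -/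
theorem apply_inverse_pseudoForm (hε : ∀ i, ε i = 1 ∨ ε i = -1)
    (α β : EuclideanSpace ℝ (Fin n) →L[ℝ] ℝ) :
    α ((pseudoForm ε).inverse β) =
      ∑ k, ε k * (α (EuclideanSpace.single k 1) * β (EuclideanSpace.single k 1)) := by
  have h := (isInvertible_pseudoForm hε).self_apply_inverse α
  conv_lhs => rw [← h]
  rw [pseudoForm_apply]
  refine Finset.sum_congr rfl fun k _ => ?_
  rw [inverse_pseudoForm_apply hε, inverse_pseudoForm_apply hε]
  linear_combination (ε k * α (EuclideanSpace.single k 1) * β (EuclideanSpace.single k 1)) *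
    sq_eq_one_of_sign hε k

theorem trace_inverse_pseudoForm_comp (hε : ∀ i, ε i = 1 ∨ ε i = -1)
    (T : EuclideanSpace ℝ (Fin n) →L[ℝ] EuclideanSpace ℝ (Fin n) →L[ℝ] ℝ) :
    LinearMap.trace ℝ (EuclideanSpace ℝ (Fin n))
      ((pseudoForm ε).inverse ∘L T :
        EuclideanSpace ℝ (Fin n) →L[ℝ] EuclideanSpace ℝ (Fin n)) =
      ∑ k, ε k * T (EuclideanSpace.single k 1) (EuclideanSpace.single k 1) := by
  rw [LinearMap.trace_eq_sum_inner _ (EuclideanSpace.basisFun (Fin n) ℝ)]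
  refine Finset.sum_congr rfl fun k _ => ?_
  simp [inverse_pseudoForm_apply hε, EuclideanSpace.inner_single_left]

theorem pd₂_eq {u : EuclideanSpace ℝ (Fin n) → ℝ} (hu : ContDiff ℝ ∞ u) (i j : Fin n)
    (x : EuclideanSpace ℝ (Fin n)) :
    pd₂ i j u x =
      fderiv ℝ (fderiv ℝ u) x (EuclideanSpace.single i 1) (EuclideanSpace.single j 1) := by
  have h := ((hu.fderiv_right (m := ∞) (by simp)).differentiable (by simp) x).hasFDerivAt.clm_apply
    (hasFDerivAt_const (EuclideanSpace.single i (1 : ℝ)) x)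
  have e : pd i u = fun x => fderiv ℝ u x (EuclideanSpace.single i 1) := rfl
  -- Unfolding differentiates along e_j last, which puts e_j first; symmetry of D²u restores the
  -- stated order.
  rw [pd₂, pd, e, h.fderiv, fderiv_fderiv_symm hu]
  simp

theorem bilin_eq_zero_iff (T : EuclideanSpace ℝ (Fin n) →L[ℝ] EuclideanSpace ℝ (Fin n) →L[ℝ] ℝ) :
    (∀ v w, T v w = 0) ↔
      ∀ i j, T (EuclideanSpace.single i 1) (EuclideanSpace.single j 1) = 0 := by
  refine ⟨fun h i j => h _ _, fun h => ?_⟩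
  have h1 : (T.toLinearMap₁₂ : _) = 0 := by
    refine (EuclideanSpace.basisFun (Fin n) ℝ).toBasis.ext fun i =>
      (EuclideanSpace.basisFun (Fin n) ℝ).toBasis.ext fun j => ?_
    simpa using h i j
  exact fun v w => DFunLike.congr_fun (DFunLike.congr_fun h1 v) w

end PseudoEuclideanCoordinates

/-! ### Splitting the quasi-Einstein equation into base and fibre equations. -/

section Conformal

variable {n : ℕ}

/-- The pseudo-Euclidean Laplacian `∑ k, ε k * u_{,kk}`. -/
def pseudoLaplacian (ε : Fin n → ℝ) (u : EuclideanSpace ℝ (Fin n) → ℝ)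
    (x : EuclideanSpace ℝ (Fin n)) : ℝ :=
  ∑ k, ε k * pd₂ k k u x

/-- The pseudo-Euclidean product `∑ k, ε k * u_{,k} * v_{,k}` of two gradients. -/
def pseudoGrad (ε : Fin n → ℝ) (u v : EuclideanSpace ℝ (Fin n) → ℝ)
    (x : EuclideanSpace ℝ (Fin n)) : ℝ :=
  ∑ k, ε k * (pd k u x * pd k v x)

theorem fderiv_inverse_pseudoForm {ε : Fin n → ℝ} (hε : ∀ i, ε i = 1 ∨ ε i = -1)
    (u v : EuclideanSpace ℝ (Fin n) → ℝ) (x : EuclideanSpace ℝ (Fin n)) :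
    fderiv ℝ u x ((pseudoForm ε).inverse (fderiv ℝ v x)) = pseudoGrad ε u v x :=
  apply_inverse_pseudoForm hε _ _

theorem trace_inverse_pseudoForm_fderiv {ε : Fin n → ℝ} (hε : ∀ i, ε i = 1 ∨ ε i = -1)
    {u : EuclideanSpace ℝ (Fin n) → ℝ} (hu : ContDiff ℝ ∞ u) (x : EuclideanSpace ℝ (Fin n)) :
    LinearMap.trace ℝ (EuclideanSpace ℝ (Fin n))
      ((pseudoForm ε).inverse ∘L fderiv ℝ (fderiv ℝ u) x :
        EuclideanSpace ℝ (Fin n) →L[ℝ] EuclideanSpace ℝ (Fin n)) = pseudoLaplacian ε u x := by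
  rw [trace_inverse_pseudoForm_comp hε, pseudoLaplacian]
  simp only [pd₂_eq hu]

/-- The horizontal part of `Ric - (r / h) Hess h - ρ g` on a warped product over a conformally flat
base, with `m`-dimensional fibre. -/
def baseDefect (m r : ℝ) (ε : Fin n → ℝ) (f φ h : EuclideanSpace ℝ (Fin n) → ℝ) (ρ : ℝ)
    (x : EuclideanSpace ℝ (Fin n)) :
    EuclideanSpace ℝ (Fin n) →L[ℝ] EuclideanSpace ℝ (Fin n) →L[ℝ] ℝ :=
  ((n - 2) / φ x) • fderiv ℝ (fderiv ℝ φ) x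
    - (m / f x) • fderiv ℝ (fderiv ℝ f) x
    - (r / h x) • fderiv ℝ (fderiv ℝ h) x
    - (m / (f x * φ x)) • ((fderiv ℝ φ x).smulRight (fderiv ℝ f x)
      + (fderiv ℝ f x).smulRight (fderiv ℝ φ x))
    - (r / (h x * φ x)) • ((fderiv ℝ φ x).smulRight (fderiv ℝ h x)
      + (fderiv ℝ h x).smulRight (fderiv ℝ φ x))
    + (pseudoLaplacian ε φ x / φ x - (n - 1) * pseudoGrad ε φ φ x / φ x ^ 2
      + m / (f x * φ x) * pseudoGrad ε φ f x + r / (h x * φ x) * pseudoGrad ε φ h x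
      - ρ / φ x ^ 2) • pseudoForm ε

/-- The coefficient of the fibre metric in `Ric - (r / h) Hess h - ρ g` on a warped product over a
conformally flat base, with an `m`-dimensional fibre of constant Ricci curvature `lam`. -/
def fibreDefect (m r : ℝ) (ε : Fin n → ℝ) (f φ h : EuclideanSpace ℝ (Fin n) → ℝ) (ρ lam : ℝ)
    (x : EuclideanSpace ℝ (Fin n)) : ℝ :=
  lam - f x * (φ x ^ 2 * pseudoLaplacian ε f x - (n - 2) * φ x * pseudoGrad ε φ f x)
    - (m - 1) * φ x ^ 2 * pseudoGrad ε f f x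
    - r / h x * f x * φ x ^ 2 * pseudoGrad ε h f x - ρ * f x ^ 2

variable {m : ℕ} {r : ℝ} {ε : Fin n → ℝ} (hε : ∀ i, ε i = 1 ∨ ε i = -1)
  {f φ h : EuclideanSpace ℝ (Fin n) → ℝ}
  (hf : ContDiff ℝ ∞ f) (hφ : ContDiff ℝ ∞ φ) (hh : ContDiff ℝ ∞ h)
  (hf_ne : ∀ x, f x ≠ 0) (hφ_ne : ∀ x, φ x ≠ 0) (hh_ne : ∀ x, h x ≠ 0) {ρ lam : ℝ}

include hε hf hφ hh hf_ne hφ_ne in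
theorem ricci_sub_hess_sub_warpedMetric
    {F : Type*} [TopologicalSpace F] [ChartedSpace (EuclideanSpace ℝ (Fin m)) F]
    [IsManifold (𝓡 m) ∞ F] {gF : TensorField₂ (𝓡 m) F} (hF : IsEinstein (𝓡 m) gF lam)
    (p : EuclideanSpace ℝ (Fin n) × F)
    (v w : EuclideanSpace ℝ (Fin n) × EuclideanSpace ℝ (Fin m)) :
    ricci ((𝓡 n).prod (𝓡 m)) (warpedMetric (𝓡 n) (𝓡 m) (conformalMetric ε φ) f gF) p v w
      - r / h p.1 * hess ((𝓡 n).prod (𝓡 m))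
        (warpedMetric (𝓡 n) (𝓡 m) (conformalMetric ε φ) f gF)
        (fun p : EuclideanSpace ℝ (Fin n) × F => h p.1) p v w
      - ρ * warpedMetric (𝓡 n) (𝓡 m) (conformalMetric ε φ) f gF p v w =
    baseDefect m r ε f φ h ρ p.1 v.1 w.1 + fibreDefect m r ε f φ h ρ lam p.1 * gF p.2 v.2 w.2 := by
  have hP := isInvertible_pseudoForm hε
  have hs := pseudoForm_symm (ε := ε)
  have hb := contDiff_conformalLocal (P := pseudoForm ε) hφ hφ_ne
  have hb' := isInvertible_conformalLocal hP hφ_ne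
  have e1 := ricci_warpedMetric (𝓡 m) hb hf hF.semiRiemannian hb' hf_ne p v w
  have e2 := hess_warpedMetric (𝓡 m) hb hf hF.semiRiemannian hb' hf_ne hh p v w
  have e3 : warpedMetric (𝓡 n) (𝓡 m) (conformalMetric ε φ) f gF p v w =
      1 / φ p.1 ^ 2 * pseudoForm ε v.1 w.1 + f p.1 ^ 2 * gF p.2 v.2 w.2 :=
    warpedMetric_apply (𝓡 m) (conformalLocal (pseudoForm ε) φ) f gF p v w
  have e0 : ricci (𝓡 m) gF p.2 v.2 w.2 = lam * gF p.2 v.2 w.2 := hF.ricci_eq p.2 v.2 w.2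
  rw [e0, ricciLocal_conformalLocal hP hs hφ hφ_ne,
    hessLocal_conformalLocal hP hs hφ hφ_ne, trace_hessOp_conformalLocal hP hs hφ hφ_ne hf,
    gradLocal_conformalLocal hP hφ_ne, map_smul, trace_inverse_pseudoForm_fderiv hε hφ,
    trace_inverse_pseudoForm_fderiv hε hf, fderiv_inverse_pseudoForm hε,
    fderiv_inverse_pseudoForm hε, fderiv_inverse_pseudoForm hε,
    finrank_euclideanSpace_fin, finrank_euclideanSpace_fin] at e1
  rw [hessLocal_conformalLocal hP hs hφ hφ_ne, gradLocal_conformalLocal hP hφ_ne, map_smul,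
    fderiv_inverse_pseudoForm hε, fderiv_inverse_pseudoForm hε] at e2
  refine (congrArg₂ (· - ·) (congrArg₂ (· - ·) e1 (congrArg (r / h p.1 * ·) e2))
    (congrArg (ρ * ·) e3)).trans ?_
  have := hf_ne p.1
  have := hφ_ne p.1
  simp only [baseDefect, fibreDefect, add_apply, sub_apply, smul_apply,
    ContinuousLinearMap.smulRight_apply, smul_eq_mul]
  -- With the two metric values opaque, what remains is a rational identity in real numbers.
  generalize gF p.2 v.2 w.2 = K
  generalize pseudoForm ε v.1 w.1 = K'
  field_simp
  ring

include hf hφ hh hf_ne hφ_ne hh_ne in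
-- The factor φ²fh clears all denominators. The δ_ij comes from the multiple of the pseudo-Euclidean
-- form, and is what separates the two families of equations.
theorem baseDefect_single (i j : Fin n) (x : EuclideanSpace ℝ (Fin n)) :
    φ x ^ 2 * f x * h x * baseDefect m r ε f φ h ρ x (EuclideanSpace.single i 1)
        (EuclideanSpace.single j 1) =
      φ x * (((n : ℝ) - 2) * f x * h x * pd₂ i j φ x - r * f x * φ x * pd₂ i j h x
        - m * h x * φ x * pd₂ i j f x
        - m * h x * pd i φ x * pd j f x - m * h x * pd j φ x * pd i f x
        - r * f x * pd i φ x * pd j h x - r * f x * pd j φ x * pd i h x)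
      + (ε i * if i = j then 1 else 0) * (∑ k, ε k * (f x * h x * φ x * pd₂ k k φ x
            - ((n : ℝ) - 1) * f x * h x * (pd k φ x) ^ 2
            + m * h x * φ x * pd k φ x * pd k f x
            + r * f x * φ x * pd k φ x * pd k h x) - ρ * f x * h x) := by
  have e : ∑ k, ε k * (f x * h x * φ x * pd₂ k k φ x
            - ((n : ℝ) - 1) * f x * h x * (pd k φ x) ^ 2
            + m * h x * φ x * pd k φ x * pd k f x
            + r * f x * φ x * pd k φ x * pd k h x) =
      f x * h x * φ x * pseudoLaplacian ε φ x - (n - 1) * f x * h x * pseudoGrad ε φ φ x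
        + m * h x * φ x * pseudoGrad ε φ f x + r * f x * φ x * pseudoGrad ε φ h x := by
    simp only [pseudoLaplacian, pseudoGrad, Finset.mul_sum, ← Finset.sum_add_distrib,
      ← Finset.sum_sub_distrib]
    exact Finset.sum_congr rfl fun k _ => by ring
  have e2 : pseudoForm ε (EuclideanSpace.single i 1) (EuclideanSpace.single j 1) =
      ε i * if i = j then 1 else 0 := by
    simp [pseudoForm_single]
  have := hf_ne x
  have := hφ_ne x
  have := hh_ne x
  rw [e, pd₂_eq hf, pd₂_eq hφ, pd₂_eq hh]
  simp only [baseDefect, add_apply, sub_apply, smul_apply,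
    ContinuousLinearMap.smulRight_apply, smul_eq_mul, e2, pd]
  field_simp
  ring

include hf hφ hh hf_ne hφ_ne hh_ne in
theorem baseDefect_eq_zero_iff (x : EuclideanSpace ℝ (Fin n)) :
    baseDefect m r ε f φ h ρ x = 0 ↔
      (∀ i j : Fin n, i ≠ j →
        ((n : ℝ) - 2) * f x * h x * pd₂ i j φ x - r * f x * φ x * pd₂ i j h x
          - m * h x * φ x * pd₂ i j f x
          - m * h x * pd i φ x * pd j f x - m * h x * pd j φ x * pd i f x
          - r * f x * pd i φ x * pd j h x - r * f x * pd j φ x * pd i h x = 0) ∧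
      (∀ i : Fin n,
        φ x * (((n : ℝ) - 2) * f x * h x * pd₂ i i φ x - r * f x * φ x * pd₂ i i h x
            - m * h x * φ x * pd₂ i i f x - 2 * m * h x * pd i φ x * pd i f x
            - 2 * r * f x * pd i φ x * pd i h x)
          + ε i * ∑ k, ε k * (f x * h x * φ x * pd₂ k k φ x
            - ((n : ℝ) - 1) * f x * h x * (pd k φ x) ^ 2
            + m * h x * φ x * pd k φ x * pd k f x
            + r * f x * φ x * pd k φ x * pd k h x)
          = ε i * ρ * f x * h x) := by
  have hB := fun i j => baseDefect_single (m := m) (r := r) (ε := ε) (ρ := ρ) hf hφ hh hf_ne hφ_ne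
    hh_ne i j x
  have hc : φ x ^ 2 * f x * h x ≠ 0 := by simp [hf_ne x, hφ_ne x, hh_ne x]
  have h0 : baseDefect m r ε f φ h ρ x = 0 ↔ ∀ i j, φ x ^ 2 * f x * h x *
      baseDefect m r ε f φ h ρ x (EuclideanSpace.single i 1) (EuclideanSpace.single j 1) = 0 := by
    simp only [mul_eq_zero_iff_left hc]
    rw [← bilin_eq_zero_iff]
    exact ⟨fun h v w => by simp [h], fun h => by ext v w; simp [h]⟩
  rw [h0]
  constructor
  · intro H
    refine ⟨fun i j hij => ?_, fun i => ?_⟩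
    · have h1 := (hB i j).symm.trans (H i j)
      rw [if_neg hij, mul_zero, zero_mul, add_zero] at h1
      -- Off the diagonal one factor φ is left over and is cancelled.
      exact (mul_eq_zero.1 h1).resolve_left (hφ_ne x)
    · have h1 := (hB i i).symm.trans (H i i)
      rw [if_pos rfl] at h1
      linear_combination h1
  · rintro ⟨H1, H2⟩ i j
    rw [hB]
    by_cases hij : i = j
    · subst hij
      rw [if_pos rfl]
      linear_combination H2 i
    · rw [if_neg hij, H1 i j hij]
      ring

include hh_ne in
theorem fibreDefect_eq_zero_iff (x : EuclideanSpace ℝ (Fin n)) :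
    fibreDefect m r ε f φ h ρ lam x = 0 ↔
      ∑ k, ε k * (-(f x * h x * (φ x) ^ 2 * pd₂ k k f x)
            + ((n : ℝ) - 2) * f x * h x * φ x * pd k φ x * pd k f x
            - ((m : ℝ) - 1) * h x * (φ x) ^ 2 * (pd k f x) ^ 2
            - r * f x * (φ x) ^ 2 * pd k f x * pd k h x)
          = h x * (ρ * (f x) ^ 2 - lam) := by
  have e : ∑ k, ε k * (-(f x * h x * (φ x) ^ 2 * pd₂ k k f x)
            + ((n : ℝ) - 2) * f x * h x * φ x * pd k φ x * pd k f x
            - ((m : ℝ) - 1) * h x * (φ x) ^ 2 * (pd k f x) ^ 2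
            - r * f x * (φ x) ^ 2 * pd k f x * pd k h x) =
      -(f x * h x * φ x ^ 2) * pseudoLaplacian ε f x
        + (n - 2) * f x * h x * φ x * pseudoGrad ε φ f x
        - (m - 1) * h x * φ x ^ 2 * pseudoGrad ε f f x
        - r * f x * φ x ^ 2 * pseudoGrad ε h f x := by
    simp only [pseudoLaplacian, pseudoGrad, Finset.mul_sum, ← Finset.sum_add_distrib,
      ← Finset.sum_sub_distrib]
    exact Finset.sum_congr rfl fun k _ => by ring
  have hx := hh_ne x
  have e2 : h x * fibreDefect m r ε f φ h ρ lam x =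
      -(f x * h x * φ x ^ 2) * pseudoLaplacian ε f x
        + (n - 2) * f x * h x * φ x * pseudoGrad ε φ f x
        - (m - 1) * h x * φ x ^ 2 * pseudoGrad ε f f x
        - r * f x * φ x ^ 2 * pseudoGrad ε h f x - h x * (ρ * (f x) ^ 2 - lam) := by
    rw [fibreDefect]
    field_simp
    ring
  rw [e, ← sub_eq_zero (b := h x * _), ← e2, mul_eq_zero_iff_left hx]

include hε hf hφ hh hf_ne hφ_ne hh_ne in
theorem isQuasiEinstein_warpedMetric_iff (hm : 1 ≤ m)
    {F : Type*} [TopologicalSpace F] [ChartedSpace (EuclideanSpace ℝ (Fin m)) F]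
    [IsManifold (𝓡 m) ∞ F] [Nonempty F] {gF : TensorField₂ (𝓡 m) F}
    (hF : IsEinstein (𝓡 m) gF lam) :
    IsQuasiEinstein ((𝓡 n).prod (𝓡 m))
        (warpedMetric (𝓡 n) (𝓡 m) (conformalMetric ε φ) f gF)
        r (fun p : EuclideanSpace ℝ (Fin n) × F => h p.1) ρ ↔
      (∀ x, baseDefect m r ε f φ h ρ x = 0) ∧ ∀ x, fibreDefect m r ε f φ h ρ lam x = 0 := by
  have key := ricci_sub_hess_sub_warpedMetric (r := r) (ρ := ρ) hε hf hφ hh hf_ne hφ_ne hF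
  constructor
  · intro H
    have h1 : ∀ (x : EuclideanSpace ℝ (Fin n)) (q : F)
        (v w : EuclideanSpace ℝ (Fin n) × EuclideanSpace ℝ (Fin m)), baseDefect m r ε f φ h ρ x v.1 w.1
        + fibreDefect m r ε f φ h ρ lam x * gF q v.2 w.2 = 0 := fun x q v w =>
      (key (x, q) v w).symm.trans (sub_eq_zero.2 (H.quasi_einstein_eq (x, q) v w))
    obtain ⟨q⟩ := ‹Nonempty F›
    refine ⟨fun x => ?_, fun x => ?_⟩
    · refine ContinuousLinearMap.ext fun v => ContinuousLinearMap.ext fun w => ?_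
      -- Horizontal vectors isolate the base form, vertical ones the fibre coefficient; one point
      -- `q` of the fibre is enough.
      have h2 := h1 x q (v, 0) (w, 0)
      have h3 : gF q 0 0 = 0 := map_zero _
      exact (add_eq_left.2 (mul_eq_zero_of_right _ h3)).symm.trans h2
    · by_contra hne
      have h2 : ∀ v w : EuclideanSpace ℝ (Fin m), gF q v w = 0 := by
        intro v w
        have h3 := h1 x q (0, v) (0, w)
        rw [map_zero, zero_add] at h3
        exact (mul_eq_zero.1 h3).resolve_left hne
      -- A nonzero coefficient would force the fibre metric to vanish at `q`; as `m ≥ 1` there is a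
      -- nonzero vector to contradict nondegeneracy.
      have h4 : EuclideanSpace.single (⟨0, hm⟩ : Fin m) (1 : ℝ) = 0 :=
        hF.semiRiemannian.nondegenerate q _ (h2 _)
      simpa using congrArg (fun v : EuclideanSpace ℝ (Fin m) => v ⟨0, hm⟩) h4
  · rintro ⟨H1, H2⟩
    refine ⟨isSemiRiemannian_warpedMetric (𝓡 m) (contDiff_conformalLocal hφ hφ_ne) hf
      hF.semiRiemannian (isInvertible_conformalLocal (isInvertible_pseudoForm hε) hφ_ne) hf_ne
      (fun x v w => congrArg (1 / φ x ^ 2 * ·) (pseudoForm_symm v w)),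
      hh.contMDiff.comp contMDiff_fst, fun p => hh_ne p.1, fun p v w => ?_⟩
    refine sub_eq_zero.1 ((key p v w).trans ?_)
    rw [H1, H2, zero_mul]
    exact add_zero 0

end Conformal

end SemiRiem

end

theorem mainTheorem3 (n m r : ℕ) (hn : 3 ≤ n) (hm : 1 ≤ m)
    (ε : Fin n → ℝ) (hε : ∀ i, ε i = 1 ∨ ε i = -1)
    {F : Type*} [TopologicalSpace F] [ChartedSpace (EuclideanSpace ℝ (Fin m)) F]
    [IsManifold (𝓡 m) ∞ F] [Nonempty F]
    (gF : SemiRiem.TensorField₂ (𝓡 m) F) (lamF : ℝ)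
    (hF : SemiRiem.IsEinstein (𝓡 m) gF lamF)
    (f φ h : EuclideanSpace ℝ (Fin n) → ℝ)
    (hf : ContDiff ℝ ∞ f) (hφ : ContDiff ℝ ∞ φ) (hh : ContDiff ℝ ∞ h)
    (hf_pos : ∀ x, 0 < f x) (hφ_ne : ∀ x, φ x ≠ 0) (hh_ne : ∀ x, h x ≠ 0) (ρ : ℝ) :
    SemiRiem.IsQuasiEinstein ((𝓡 n).prod (𝓡 m))
        (SemiRiem.warpedMetric (𝓡 n) (𝓡 m) (SemiRiem.conformalMetric ε φ) f gF)
        r (fun p : EuclideanSpace ℝ (Fin n) × F => h p.1) ρ ↔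
      (∀ i j : Fin n, i ≠ j → ∀ x,
        ((n : ℝ) - 2) * f x * h x * SemiRiem.pd₂ i j φ x
          - r * f x * φ x * SemiRiem.pd₂ i j h x
          - m * h x * φ x * SemiRiem.pd₂ i j f x
          - m * h x * SemiRiem.pd i φ x * SemiRiem.pd j f x
          - m * h x * SemiRiem.pd j φ x * SemiRiem.pd i f x
          - r * f x * SemiRiem.pd i φ x * SemiRiem.pd j h x
          - r * f x * SemiRiem.pd j φ x * SemiRiem.pd i h x = 0) ∧
      (∀ i : Fin n, ∀ x,
        φ x * (((n : ℝ) - 2) * f x * h x * SemiRiem.pd₂ i i φ x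
            - r * f x * φ x * SemiRiem.pd₂ i i h x
            - m * h x * φ x * SemiRiem.pd₂ i i f x
            - 2 * m * h x * SemiRiem.pd i φ x * SemiRiem.pd i f x
            - 2 * r * f x * SemiRiem.pd i φ x * SemiRiem.pd i h x)
          + ε i * ∑ k, ε k * (f x * h x * φ x * SemiRiem.pd₂ k k φ x
            - ((n : ℝ) - 1) * f x * h x * (SemiRiem.pd k φ x) ^ 2
            + m * h x * φ x * SemiRiem.pd k φ x * SemiRiem.pd k f x
            + r * f x * φ x * SemiRiem.pd k φ x * SemiRiem.pd k h x)
          = ε i * ρ * f x * h x) ∧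
      (∀ x,
        ∑ k, ε k * (-(f x * h x * (φ x) ^ 2 * SemiRiem.pd₂ k k f x)
            + ((n : ℝ) - 2) * f x * h x * φ x * SemiRiem.pd k φ x * SemiRiem.pd k f x
            - ((m : ℝ) - 1) * h x * (φ x) ^ 2 * (SemiRiem.pd k f x) ^ 2
            - r * f x * (φ x) ^ 2 * SemiRiem.pd k f x * SemiRiem.pd k h x)
          = h x * (ρ * (f x) ^ 2 - lamF)) := by 
  have hf_ne : ∀ x, f x ≠ 0 := fun x => (hf_pos x).ne'
  rw [SemiRiem.isQuasiEinstein_warpedMetric_iff hε hf hφ hh hf_ne hφ_ne hh_ne hm hF]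
  -- After this the two sides differ only in the order of quantifiers and conjunctions.
  simp only [SemiRiem.baseDefect_eq_zero_iff hf hφ hh hf_ne hφ_ne hh_ne,
    SemiRiem.fibreDefect_eq_zero_iff hh_ne]
  constructor
  · rintro ⟨H1, H2⟩
    exact ⟨fun i j hij x => (H1 x).1 i j hij, fun i x => (H1 x).2 i, H2⟩
  · rintro ⟨H1, H2, H3⟩
    exact ⟨fun x => ⟨fun i j hij => H1 i j hij x, fun i => H2 i x⟩, H3⟩
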